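/- An argumentation framework (AF) is a finite directed graph $F=(A,R)$ with $A\neq\emptyset$ and $R\subseteq A\times A$. For $E\subseteq A$ let $E^+=E\cup\{a \mid (b,a)\in R \text{ for some } b\in E\}$; $a\in A$ is defended by $E$ if for every $(a',a)\in R$ there is $a''\in E$ with $(a'',a')\in R$. The set $E$ is conflict-free if $(E\times E)\cap R=\emptyset$, and admissible (adm) if it is conflict-free and defends all its elements. An admissible $E$ is complete (comp) if it contains every argument it defends, stable (stab) if every $a\in A\setminus E$ is attacked by some element of $E$, preferred (pref) if no admissible set properly contains $E$, and semi-stable (semi) if there is no admissible $E'$ with $E^+\subsetneq E'^+$. A conflict-free $E$ is stage (stag) if there is no conflict-free $E'$ with $E^+\subsetneq E'^+$. For $\sigma\in\{\mathrm{adm},\mathrm{comp},\mathrm{stab},\mathrm{pref},\mathrm{semi},\mathrm{stag}\}$ let $\sigma(F)$ be the set of all $\sigma$-extensions, and for $a\in A$ let $\sigma^{a}(F)=\{E\in\sigma(F)\mid a\in E\}$ and $\sigma^{\bar a}(F)=\{E\in\sigma(F)\mid a\notin E\}$. Let $\mathrm{Facet}_\sigma(F)$ be the set of arguments that belong to some but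 not to all $E\in\sigma(F)$, and for $\ell\in\{a,\bar a\}$ let $\mathrm{Facet}^{\ell}_\sigma(F)$ be the set of arguments that belong to some but not to all $E\in\sigma^{\ell}(F)$. For a facet $a\in\mathrm{Facet}_\sigma(F)$ and $\ell\in\{a,\bar a\}$ the significance of $\ell$ is $$\mathrm{Imp}_\sigma[F,\ell]=\frac{|\mathrm{Facet}_\sigma(F)|-|\mathrm{Facet}^{\ell}_\sigma(F)|}{|\mathrm{Facet}_\sigma(F)|}.$$ Theorem. Let $\sigma$ be one of the six semantics above. Each of the following three tasks is solved by a deterministic polynomial-time Turing machine with access to an $\mathrm{NP}$ oracle if $\sigma\in\{\mathrm{adm},\mathrm{comp},\mathrm{stab}\}$, and with access to a $\Sigma_2^{\mathrm P}=\mathrm{NP}^{\mathrm{NP}}$ oracle if $\sigma\in\{\mathrm{pref},\mathrm{semi},\mathrm{stag}\}$: 1. given an AF $F=(A,R)$, compute the set $\mathrm{Facet}_\sigma(F)$; 2. given an AF $F=(A,R)$ and $\ell\in\{a,\bar a\}$ with $a\in A$, compute the set $\mathrm{Facet}^{\ell}_\sigma(F)$; 3. given an AF $F=(A,R)$ and $\ell\in\{a,\bar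 a\}$ with $a\in\mathrm{Facet}_\sigma(F)$, compute the rational number $\mathrm{Imp}_\sigma[F,\ell]$ (as a fraction). That is, they are computable in the function versions of $\Delta_2^{\mathrm P}=\mathrm P^{\mathrm{NP}}$ and $\Delta_3^{\mathrm P}=\mathrm P^{\Sigma_2^{\mathrm P}}$, respectively. -/

import Mathlib

/-! ### Argumentation frameworks, semantics, facets, significance -/

namespace Argumentation

/-- An argumentation framework on the set `A` of arguments: `attacks a b` means `(a, b) ∈ R`. -/
structure AF (A : Type*) where
  attacks : A → A → Prop

namespace AF

variable {A : Type*} (F : AF A)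

def ConflictFree (E : Set A) : Prop :=
  ∀ a ∈ E, ∀ b ∈ E, ¬ F.attacks a b

/-- The set of all arguments that are defended by `E`. -/
def defended (E : Set A) : Set A :=
  {a | ∀ a', F.attacks a' a → ∃ a'' ∈ E, F.attacks a'' a'}

/-- The range `E⁺` of `E`: the arguments in `E` or attacked by `E`. -/
def range (E : Set A) : Set A :=
  E ∪ {a | ∃ b ∈ E, F.attacks b a}

def Admissible (E : Set A) : Prop :=
  F.ConflictFree E ∧ E ⊆ F.defended E

def Complete (E : Set A) : Prop :=
  F.Admissible E ∧ F.defended E = E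

def Stable (E : Set A) : Prop :=
  F.Admissible E ∧ ∀ a ∉ E, ∃ a' ∈ E, F.attacks a' a

def Preferred (E : Set A) : Prop :=
  F.Admissible E ∧ ¬ ∃ E', E ⊂ E' ∧ F.Admissible E'

def SemiStable (E : Set A) : Prop :=
  F.Admissible E ∧ ¬ ∃ E', F.Admissible E' ∧ F.range E ⊂ F.range E'

def Stage (E : Set A) : Prop :=
  F.ConflictFree E ∧ ¬ ∃ E', F.ConflictFree E' ∧ F.range E ⊂ F.range E'

end AF

inductive Semantics
  | adm | comp | stab | pref | semi | stag

/-- `σ(F)`, the set of all `σ`-extensions of `F`. -/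
def Semantics.extensions {A : Type*} : Semantics → AF A → Set (Set A)
  | adm, F => {E | F.Admissible E}
  | comp, F => {E | F.Complete E}
  | stab, F => {E | F.Stable E}
  | pref, F => {E | F.Preferred E}
  | semi, F => {E | F.SemiStable E}
  | stag, F => {E | F.Stage E}

/-- A literal: approving (`pos a`) or disapproving (`neg a`) the argument `a`. -/
inductive Literal (A : Type*)
  | pos (a : A)
  | neg (a : A)

def Literal.arg {A : Type*} : Literal A → A
  | pos a => a
  | neg a => a

/-- The extensions of a family that approve the literal. -/
def approving {A : Type*} (X : Set (Set A)) : Literal A → Set (Set A)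
  | .pos a => {E ∈ X | a ∈ E}
  | .neg a => {E ∈ X | a ∉ E}

/-- Arguments accepted in some extension of the family `X`. -/
def cred {A : Type*} (X : Set (Set A)) : Set A := {b | ∃ E ∈ X, b ∈ E}

/-- Arguments accepted in all extensions of the family `X`. -/
def skep {A : Type*} (X : Set (Set A)) : Set A := {b | ∀ E ∈ X, b ∈ E}

/-- The set of `σ`-facets of `F`. -/
def facets {A : Type*} (σ : Semantics) (F : AF A) : Set A :=
  cred (σ.extensions F) \ skep (σ.extensions F)

/-- The set of `σ`-facets of `F` under approval of the literal `ℓ`. -/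
def facetsUnder {A : Type*} (σ : Semantics) (F : AF A) (ℓ : Literal A) : Set A :=
  cred (approving (σ.extensions F) ℓ) \ skep (approving (σ.extensions F) ℓ)

/-- The significance of approving `ℓ`. -/
noncomputable def significance {A : Type*} (σ : Semantics) (F : AF A) (ℓ : Literal A) : ℚ :=
  (((facets σ F).ncard : ℚ) - ((facetsUnder σ F ℓ).ncard : ℚ)) / ((facets σ F).ncard : ℚ)

end Argumentation

/-! ### Multi-tape oracle Turing machines -/

namespace OracleComplexity

/-- Tape symbols: the bits and the blank `none`. -/
abbrev Symbol := Option Bool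

/-- What a machine with tapes `K` and control states `Q` does in a given state. -/
inductive Instr (K Q : Type)
  /-- Depending on the symbols under all heads, write a symbol on every tape, then move every head
  by at most one cell (`none`: do not move), and go to a new state. -/
  | act (δ : (K → Symbol) → Q × (K → Symbol × Option Turing.Dir))
  /-- Nondeterministically go to one of two states. -/
  | guess (q₀ q₁ : Q)
  /-- Ask whether the word on the query tape is in the oracle language. -/
  | query (yes no : Q)
  | halt (accept : Bool)

structure OracleTM where
  /-- the tapes -/
  K : Type
  /-- the control states -/
  Q : Type
  [kFin : Fintype K]
  [kDec : DecidableEq K]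
  [qFin : Fintype Q]
  inTape : K
  queryTape : K
  outTape : K
  start : Q
  prog : Q → Instr K Q

attribute [instance] OracleTM.kFin OracleTM.kDec OracleTM.qFin

/-- The word on a tape: the bits from the head to the right, up to the first blank. -/
def readWord (T : Turing.Tape Symbol) : List Bool :=
  Turing.ListBlank.liftOn T.right₀ (fun l => (l.takeWhile Option.isSome).reduceOption) (by
    rintro a _ ⟨n, rfl⟩
    have h : ∀ m : ℕ, (List.replicate m (default : Symbol)).takeWhile Option.isSome = [] := by
      intro m
      cases m with
      | zero => rfl
      | succ m => rfl
    induction a with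
    | nil => simp [h]
    | cons x a ih =>
      cases x with
      | none => simp
      | some x => simpa [List.takeWhile_cons, List.reduceOption] using ih)

/-- The tape that holds just the word `w`, with the head on its first symbol. -/
def wordTape (w : List Bool) : Turing.Tape Symbol := Turing.Tape.mk₁ (w.map some)

namespace OracleTM

variable (M : OracleTM) (O : Set (List Bool))

structure Cfg where
  state : M.Q
  tape : M.K → Turing.Tape Symbol

/-- Initially the input is on the input tape and all other tapes are blank. -/
def init (w : List Bool) : M.Cfg where
  state := M.start
  tape k := if k = M.inTape then wordTape w else wordTape []

open Classical in
/-- One step with oracle `O`; the bit `b` resolves a nondeterministic guess and is ignored in all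
other states. The value is `none` exactly if the machine has halted. -/
noncomputable def step (b : Bool) (c : M.Cfg) : Option M.Cfg :=
  match M.prog c.state with
  | .act δ =>
    let r := δ (fun k => (c.tape k).head)
    some
      { state := r.1
        tape := fun k =>
          let T := (c.tape k).write (r.2 k).1
          match (r.2 k).2 with
          | none => T
          | some d => T.move d }
  | .guess q₀ q₁ => some { c with state := if b then q₁ else q₀ }
  | .query yes no =>
    some { c with state := if readWord (c.tape M.queryTape) ∈ O then yes else no }
  | .halt _ => none

/-- `M.ReachesIn O t c c'`: some computation with oracle `O` leads from `c` to `c'` in exactly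
`t` steps. -/
inductive ReachesIn : ℕ → M.Cfg → M.Cfg → Prop
  | refl (c : M.Cfg) : ReachesIn 0 c c
  | head {t : ℕ} {b : Bool} {c c' c'' : M.Cfg} :
      M.step O b c = some c' → ReachesIn t c' c'' → ReachesIn (t + 1) c c''

def Halted (c : M.Cfg) : Prop := ∃ v, M.prog c.state = .halt v

def Accepting (c : M.Cfg) : Prop := M.prog c.state = .halt true

/-- A deterministic machine never guesses. -/
def Deterministic : Prop := ∀ q q₀ q₁, M.prog q ≠ .guess q₀ q₁

end OracleTM

/-- `NP` relative to the oracle `O`: the languages decided by a nondeterministic machine with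
oracle `O` all of whose computations halt within polynomially many steps. -/
def NPRel (O : Set (List Bool)) : Set (Set (List Bool)) :=
  {L | ∃ (M : OracleTM) (p : Polynomial ℕ), ∀ w : List Bool,
    (∀ t c, M.ReachesIn O t (M.init w) c → t ≤ p.eval w.length) ∧
    (w ∈ L ↔ ∃ t c, M.ReachesIn O t (M.init w) c ∧ M.Accepting c)}

/-- `NP`: nondeterministic polynomial time, without an oracle (with the empty one). -/
def NP : Set (Set (List Bool)) := NPRel ∅

/-- The second level `Σ₂ᴾ = NP^NP` of the polynomial hierarchy. -/
def Sigma2P : Set (Set (List Bool)) := {L | ∃ O ∈ NP, L ∈ NPRel O}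

/-- The instances `x : α`, presented to the machine as the words `enc x`, are solved by a
deterministic polynomial-time Turing machine with access to an oracle from the class `C`. Here
`Sol x w` says that the word `w` is a correct output for `x`. -/
def PolyTimeWithOracle (C : Set (Set (List Bool))) {α : Type} (enc : α → List Bool)
    (Sol : α → List Bool → Prop) : Prop :=
  ∃ O ∈ C, ∃ (M : OracleTM) (p : Polynomial ℕ), M.Deterministic ∧
    ∀ x : α, ∃ t ≤ p.eval (enc x).length, ∃ c,
      M.ReachesIn O t (M.init (enc x)) c ∧ M.Halted c ∧ Sol x (readWord (c.tape M.outTape))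

end OracleComplexity

/-! ### Inputs and outputs as words -/

namespace Argumentation

/-- A finite non-empty argumentation framework, with its arguments numbered `0, …, n - 1`. -/
structure FinAF where
  n : ℕ
  n_pos : 0 < n
  F : AF (Fin n)

/-- A finite non-empty argumentation framework together with a literal over its arguments. -/
structure FinAFLit extends FinAF where
  ℓ : Literal (Fin n)

open Classical in
/-- The characteristic word of a set of arguments. -/
noncomputable def setWord {n : ℕ} (S : Set (Fin n)) : List Bool :=
  List.ofFn fun i => decide (i ∈ S)

/-- A framework is presented as `1ⁿ0` followed by the rows of its adjacency matrix. -/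
noncomputable def FinAF.word (I : FinAF) : List Bool :=
  List.replicate I.n true ++ false ::
    (List.ofFn fun i : Fin I.n => setWord {j | I.F.attacks i j}).flatten

/-- A literal over the argument number `i` is presented as a sign bit followed by `1ⁱ0`. -/
def litWord {n : ℕ} : Literal (Fin n) → List Bool
  | .pos a => true :: (List.replicate a true ++ [false])
  | .neg a => false :: (List.replicate a true ++ [false])

noncomputable def FinAFLit.word (I : FinAFLit) : List Bool :=
  litWord I.ℓ ++ I.toFinAF.word

/-- The word `1ᵖ01ᑫ` represents the rational number `p / q`, where `q > 0`. -/
def RepresentsRat (r : ℚ) (w : List Bool) : Prop :=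
  ∃ p q : ℕ, 0 < q ∧ r = (p : ℚ) / (q : ℚ) ∧
    w = List.replicate p true ++ false :: List.replicate q true

/-- The inputs of the significance score: literals over a `σ`-facet. -/
def FacetLit (σ : Semantics) : Type := {I : FinAFLit // I.ℓ.arg ∈ facets σ I.F}

/-- `F ↦ Facet_σ(F)` is computable in deterministic polynomial time with an oracle from `C`. -/
def FacetsComputable (C : Set (Set (List Bool))) (σ : Semantics) : Prop :=
  OracleComplexity.PolyTimeWithOracle C FinAF.word fun I w => w = setWord (facets σ I.F)

/-- `(F, ℓ) ↦ Facet_σ^ℓ(F)` is computable in deterministic polynomial time with an oracle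
from `C`. -/
def FacetsUnderComputable (C : Set (Set (List Bool))) (σ : Semantics) : Prop :=
  OracleComplexity.PolyTimeWithOracle C FinAFLit.word fun I w =>
    w = setWord (facetsUnder σ I.F I.ℓ)

/-- The significance of a literal over a `σ`-facet is computable in deterministic polynomial time
with an oracle from `C`. -/
def SignificanceComputable (C : Set (Set (List Bool))) (σ : Semantics) : Prop :=
  OracleComplexity.PolyTimeWithOracle C (fun I : FacetLit σ => I.1.word) fun I w =>
    RepresentsRat (significance σ I.1.F I.1.ℓ) w

end Argumentation

/-! ### Tapes that hold words -/

namespace OracleComplexity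

open Turing

/-! All three tasks reduce to one kind of question: given `F`, sets `P` and `N` of arguments and an
argument `i`, are there two `σ`-extensions that contain `P` and avoid `N`, one with `i` and one
without? For `P = N = ∅` this asks whether `i` is a facet; for `P = {a}` or `N = {a}` it asks
whether `i` is a facet under the literal. A deterministic machine asks both questions for each of
the `n` arguments. As facets under a literal are facets (`facetsUnder_subset`), the significance is
the cardinality of a difference of sets over the cardinality of the larger one, and both can be
written in unary.

The question is answered by guessing the two extensions and verifying them. Verification rests on
images under the attack relation: a set is conflict-free iff it is disjoint from the set it attacks,
and the undefended arguments are those attacked from outside the attacked set (`mem_defended_iff`).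
For admissible, complete and stable extensions this is a polynomial-time check, so the question is
in `NP`. For preferred, semi-stable and stage extensions one must also exclude an admissible (or
conflict-free) set that is larger or has larger range. The existence of such a set is an `NP`
property (`improveOracle_improveLanguage`), so the question is in `NP` relative to an `NP` oracle
(`facetOracle_facetLanguage`).

Most of the work is to run this on multi-tape Turing machines. Sets of arguments are kept as
characteristic words on parallel tapes, the registers, so that a column belongs to one argument. A
few instructions on such registers are compiled into control states, each with at most quadratic
running time (`exec_detReach`, `guess_decides`). Straight-line programs of these instructions have a
purely logical acceptance condition `Accepts` and define languages in `NPRel O`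
(`accepts_mem_NPRel`). The deterministic machine uses the same instructions in a loop over the
arguments (`rounds_detReach`). -/

/-- The tape with the word `l` (reversed) to the left of the head and the word `r` from the head
to the right. -/
def tapeAt (l r : List Bool) : Tape Symbol :=
  Tape.mk' (ListBlank.mk (l.map some)) (ListBlank.mk (r.map some))

@[simp]
theorem tapeAt_head_cons (l r : List Bool) (b : Bool) : (tapeAt l (b :: r)).head = some b := rfl

@[simp]
theorem tapeAt_head_nil (l : List Bool) : (tapeAt l []).head = none := rfl

@[simp]
theorem tapeAt_write_cons (l r : List Bool) (b c : Bool) :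
    (tapeAt l (b :: r)).write (some c) = tapeAt l (c :: r) := rfl

@[simp]
theorem tapeAt_write_nil (l : List Bool) (c : Bool) :
    (tapeAt l []).write (some c) = tapeAt l [c] := rfl

@[simp]
theorem tapeAt_move_right (l r : List Bool) (b : Bool) :
    (tapeAt l (b :: r)).move .right = tapeAt (b :: l) r := by
  simp [tapeAt, Tape.move_right_mk']

@[simp]
theorem tapeAt_move_left (l r : List Bool) (b : Bool) :
    (tapeAt (b :: l) r).move .left = tapeAt l (b :: r) := by
  simp [tapeAt, Tape.move_left_mk']

@[simp]
theorem tapeAt_move_left_nil_head (r : List Bool) : ((tapeAt [] r).move .left).head = none := rfl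

-- This is a push: the cell to the left of the top is blank, and writing there extends the word.
@[simp]
theorem tapeAt_move_left_nil_write (r : List Bool) (b : Bool) :
    ((tapeAt [] r).move .left).write (some b) = tapeAt [] (b :: r) := by
  have h : (tapeAt [] r).move .left = Tape.mk' (ListBlank.mk []) (ListBlank.mk (none :: r.map some)) := by
    simp only [tapeAt, Tape.move_left_mk', List.map_nil, ListBlank.tail_mk, ListBlank.head_mk,
      ListBlank.cons_mk]
    rfl
  rw [h]
  rfl

/-- `ListBlank` identifies words up to trailing blanks, so a cell erased at the left end disappears.
Hence a pop leaves a tape of the form `tapeAt [] r` again. -/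
theorem listBlank_cons_none : ListBlank.cons (none : Symbol) (ListBlank.mk []) = ListBlank.mk [] := by
  rw [ListBlank.cons_mk]
  exact (Quotient.sound' (Or.inl ⟨1, rfl⟩) : ListBlank.mk [] = ListBlank.mk [none]).symm

@[simp]
theorem tapeAt_erase_cons (r : List Bool) (b : Bool) :
    ((tapeAt [] (b :: r)).write none).move .right = tapeAt [] r := by
  have h : (tapeAt [] (b :: r)).write none
      = Tape.mk' (ListBlank.mk []) (ListBlank.mk (none :: r.map some)) := rfl
  rw [h, Tape.move_right_mk', ListBlank.head_mk, ListBlank.tail_mk]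
  exact congrArg (fun L => Tape.mk' L _) listBlank_cons_none

@[simp]
theorem tapeAt_erase_nil : ((tapeAt [] []).write none).move .right = tapeAt [] [] := by
  have h : (tapeAt [] []).write none = Tape.mk' (ListBlank.mk []) (ListBlank.mk []) := rfl
  rw [h, Tape.move_right_mk', ListBlank.head_mk, ListBlank.tail_mk]
  exact congrArg (fun L => Tape.mk' L _) listBlank_cons_none

theorem tapeAt_erase (r : List Bool) :
    ((tapeAt [] r).write none).move .right = tapeAt [] r.tail := by
  cases r <;> simp

theorem readWord_wordTape (w : List Bool) : readWord (wordTape w) = w := by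
  have h : readWord (wordTape w) = ((w.map some).takeWhile Option.isSome).reduceOption := by
    have h' : (wordTape w).right₀ = ListBlank.mk (w.map some) := Tape.mk'_right₀ _ _
    rw [readWord, h']
    rfl
  rw [h]
  clear h
  induction w with
  | nil => rfl
  | cons b w ih => simpa [List.takeWhile_cons, List.reduceOption] using ih

/-! ### Bounded computations -/

namespace OracleTM

variable {M : OracleTM} {O : Set (List Bool)}

/-- A computation without guesses leads from `c` to `c'` in at most `t` steps. -/
inductive DetReach (M : OracleTM) (O : Set (List Bool)) : ℕ → M.Cfg → M.Cfg → Prop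
  | refl (t : ℕ) (c : M.Cfg) : DetReach M O t c c
  | head {t : ℕ} {c c' c'' : M.Cfg} :
      (∀ b, M.step O b c = some c') → DetReach M O t c' c'' → DetReach M O (t + 1) c c''

theorem DetReach.mono {t t' : ℕ} {c c' : M.Cfg} (h : DetReach M O t c c') (ht : t ≤ t') :
    DetReach M O t' c c' := by
  induction h generalizing t' with
  | refl => exact .refl _ _
  | head hs _ ih =>
    obtain ⟨t', rfl⟩ : ∃ k, t' = k + 1 := ⟨t' - 1, by omega⟩
    exact .head hs (ih (by omega))

theorem DetReach.trans {t t' : ℕ} {c c' c'' : M.Cfg} (h : DetReach M O t c c')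
    (h' : DetReach M O t' c' c'') : DetReach M O (t + t') c c'' := by
  induction h with
  | refl => exact h'.mono (by omega)
  | head hs _ ih => exact (DetReach.head hs (ih h')).mono (by omega)

theorem DetReach.exists_reachesIn {t : ℕ} {c c' : M.Cfg} (h : DetReach M O t c c') :
    ∃ s ≤ t, M.ReachesIn O s c c' := by
  induction h with
  | refl => exact ⟨0, Nat.zero_le _, .refl _⟩
  | head hs _ ih =>
    obtain ⟨s, hs', hr⟩ := ih
    exact ⟨s + 1, by omega, .head (hs true) hr⟩

/-- All computations from `c` have at most `T` steps, and one of them accepts iff `A` holds. -/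
def Decides (M : OracleTM) (O : Set (List Bool)) (c : M.Cfg) (T : ℕ) (A : Prop) : Prop :=
  (∀ t c', M.ReachesIn O t c c' → t ≤ T) ∧ (A ↔ ∃ t c', M.ReachesIn O t c c' ∧ M.Accepting c')

theorem Decides.mono {c : M.Cfg} {T T' : ℕ} {A : Prop} (h : M.Decides O c T A) (hT : T ≤ T') :
    M.Decides O c T' A :=
  ⟨fun t c' hr => (h.1 t c' hr).trans hT, h.2⟩

theorem Decides.congr {c : M.Cfg} {T : ℕ} {A B : Prop} (h : M.Decides O c T A) (hAB : A ↔ B) :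
    M.Decides O c T B :=
  ⟨h.1, hAB.symm.trans h.2⟩

theorem Decides.halt {c : M.Cfg} {v : Bool} (h : M.prog c.state = .halt v) (T : ℕ) :
    M.Decides O c T (v = true) := by
  have hs : ∀ b, M.step O b c = none := fun b => by simp [step, h]
  constructor
  · intro t c' hr
    cases hr with
    | refl => exact Nat.zero_le _
    | head h' => simp [hs] at h'
  · constructor
    · rintro rfl
      exact ⟨0, c, .refl _, h⟩
    · rintro ⟨t, c', hr, hacc⟩
      cases hr with
      | refl => simpa [Accepting, h] using hacc
      | head h' => simp [hs] at h'

/-- Acceptance after a step is the disjunction over the guessed bit. Deterministic steps are the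
case of a constant `c'`. -/
theorem Decides.step {c : M.Cfg} {T : ℕ} {c' : Bool → M.Cfg} {A : Bool → Prop}
    (hs : ∀ b, M.step O b c = some (c' b)) (h : ∀ b, M.Decides O (c' b) T (A b)) :
    M.Decides O c (T + 1) (∃ b, A b) := by
  have hacc : ¬ M.Accepting c := fun h => by
    have := hs true
    simp only [Accepting] at h
    simp [OracleTM.step, h] at this
  constructor
  · intro t d hr
    cases hr with
    | refl => exact Nat.zero_le _
    | @head t b _ e _ h' hr' =>
      rw [hs] at h'
      obtain rfl := Option.some.inj h'
      have := (h b).1 _ _ hr'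
      omega
  · constructor
    · rintro ⟨b, hb⟩
      obtain ⟨t, d, hr, hd⟩ := (h b).2.1 hb
      exact ⟨t + 1, d, .head (hs b) hr, hd⟩
    · rintro ⟨t, d, hr, hd⟩
      cases hr with
      | refl => exact absurd hd hacc
      | @head t b _ e _ h' hr' =>
        rw [hs] at h'
        obtain rfl := Option.some.inj h'
        exact ⟨b, (h b).2.2 ⟨t, d, hr', hd⟩⟩

/-- Each step of `DetReach` has the same successor for both values of the bit, so the disjunction in
`Decides.step` collapses. -/
theorem Decides.of_detReach {t T : ℕ} {c c' : M.Cfg} {A : Prop} (hr : DetReach M O t c c')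
    (h : M.Decides O c' T A) : M.Decides O c (t + T) A := by
  induction hr with
  | refl => exact h.mono (by omega)
  | head hs _ ih =>
    exact ((Decides.step hs fun _ => ih h).congr (by simp)).mono (by omega)

end OracleTM

end OracleComplexity

namespace OracleComplexity

open Turing

/-! ### Machines with registers

The tapes of these machines are the input, query and output tapes, used as stacks, and registers,
all of which hold words of the same length. -/

inductive RegTape (R : Type)
  | reg (r : R)
  | inp
  | qry
  | out
  deriving DecidableEq, Fintype

/-- What to do with a tape: the symbol to write, if any, then the direction to move. -/
abbrev TapeAct := Option Symbol × Option Dir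

def TapeAct.apply (a : TapeAct) (T : Tape Symbol) : Tape Symbol :=
  let T' := T.write (a.1.getD T.head)
  match a.2 with
  | none => T'
  | some d => T'.move d

def stay : TapeAct := (none, none)

def goLeft : TapeAct := (none, some .left)

def goRight : TapeAct := (none, some .right)

def put (b : Bool) : TapeAct := (some (some b), none)

def putLeft (b : Bool) : TapeAct := (some (some b), some .left)

def putRight (b : Bool) : TapeAct := (some (some b), some .right)

/-- Remove the top of a stack. -/
def erase : TapeAct := (some none, some .right)

@[simp]
theorem stay_apply (T : Tape Symbol) : stay.apply T = T := T.write_self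

@[simp]
theorem goLeft_apply (T : Tape Symbol) : goLeft.apply T = T.move .left := by
  simp [goLeft, TapeAct.apply]

@[simp]
theorem goRight_apply (T : Tape Symbol) : goRight.apply T = T.move .right := by
  simp [goRight, TapeAct.apply]

@[simp]
theorem put_apply (b : Bool) (T : Tape Symbol) : (put b).apply T = T.write (some b) := rfl

@[simp]
theorem putLeft_apply (b : Bool) (T : Tape Symbol) :
    (putLeft b).apply T = (T.write (some b)).move .left := rfl

@[simp]
theorem putRight_apply (b : Bool) (T : Tape Symbol) :
    (putRight b).apply T = (T.write (some b)).move .right := rfl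

@[simp]
theorem erase_apply (r : List Bool) : erase.apply (tapeAt [] r) = tapeAt [] r.tail :=
  tapeAt_erase r

variable {R Q : Type}

/-- Assemble data for all tapes. -/
def onTapes {α : Type} (f : R → α) (i q o : α) : RegTape R → α
  | .reg r => f r
  | .inp => i
  | .qry => q
  | .out => o

/-- The instruction that performs the actions `D h` if `h` are the symbols under the heads. -/
def actInstr (D : (RegTape R → Symbol) → Q × (RegTape R → TapeAct)) : Instr (RegTape R) Q :=
  .act fun h => ((D h).1, fun k => ((((D h).2 k).1.getD (h k)), ((D h).2 k).2))

/-- A contiguous piece of the register tapes: the columns `l` (reversed) to the left of the heads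
and the columns `v` from the heads to the right. -/
def colTape (l v : List (R → Bool)) (r : R) : Tape Symbol :=
  tapeAt (l.map (· r)) (v.map (· r))

@[simp]
theorem colTape_nil_head (l : List (R → Bool)) (r : R) : (colTape l [] r).head = none := rfl

@[simp]
theorem colTape_cons_head (l v : List (R → Bool)) (c : R → Bool) (r : R) :
    (colTape l (c :: v) r).head = some (c r) := rfl

@[simp]
theorem colTape_move_left (l v : List (R → Bool)) (c : R → Bool) (r : R) :
    (colTape (c :: l) v r).move .left = colTape l (c :: v) r := by
  simp [colTape]

@[simp]
theorem colTape_move_right (l v : List (R → Bool)) (c : R → Bool) (r : R) :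
    (colTape l (c :: v) r).move .right = colTape (c :: l) v r := by
  simp [colTape]

@[simp]
theorem colTape_move_left_head (v : List (R → Bool)) (r : R) :
    ((colTape [] v r).move .left).head = none := rfl

@[simp]
theorem colTape_write_move_right (l v : List (R → Bool)) (c : R → Bool) (b : R → Bool) (r : R) :
    ((colTape l (c :: v) r).write (some (b r))).move .right = colTape (b :: l) v r := by
  simp [colTape]

variable [Fintype R] [DecidableEq R] [Fintype Q]

/-- The machine with the given program. -/
def regMachine (prog : Q → Instr (RegTape R) Q) (start : Q) (o : RegTape R) : OracleTM where
  K := RegTape R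
  Q := Q
  inTape := .inp
  queryTape := .qry
  outTape := o
  start := start
  prog := prog

variable {prog : Q → Instr (RegTape R) Q} {start : Q} {o : RegTape R} {O : Set (List Bool)}

/-- The configuration with the given state and tapes. -/
def regCfg (prog : Q → Instr (RegTape R) Q) (start : Q) (o : RegTape R) (q : Q)
    (f : R → Tape Symbol) (ti tq tO : Tape Symbol) : (regMachine prog start o).Cfg where
  state := q
  tape := onTapes f ti tq tO

/-- The symbols under the heads. -/
def heads (f : R → Tape Symbol) (ti tq tO : Tape Symbol) : RegTape R → Symbol :=
  onTapes (fun r => (f r).head) ti.head tq.head tO.head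

theorem regMachine_step_act {q : Q} {δ : (RegTape R → Symbol) → Q × (RegTape R → TapeAct)}
    (hq : prog q = actInstr δ) {f f' : R → Tape Symbol} {ti ti' tq tq' tO tO' : Tape Symbol} {q' : Q}
    (h : (δ (heads f ti tq tO)).1 = q')
    (hf : ∀ r, ((δ (heads f ti tq tO)).2 (.reg r)).apply (f r) = f' r)
    (hi : ((δ (heads f ti tq tO)).2 .inp).apply ti = ti')
    (hqr : ((δ (heads f ti tq tO)).2 .qry).apply tq = tq')
    (ho : ((δ (heads f ti tq tO)).2 .out).apply tO = tO') (b : Bool) :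
    (regMachine prog start o).step O b (regCfg prog start o q f ti tq tO) =
      some (regCfg prog start o q' f' ti' tq' tO') := by
  have hh : (fun k => ((regCfg prog start o q f ti tq tO).tape k).head) = heads f ti tq tO := by
    funext k; cases k <;> rfl
  have hp : (regMachine prog start o).prog (regCfg prog start o q f ti tq tO).state = actInstr δ := hq
  rw [OracleTM.step, hp, actInstr]
  simp only [hh]
  congr 1
  simp only [regCfg]
  congr 1
  funext k
  cases k with
  | reg r => exact hf r
  | inp => exact hi
  | qry => exact hqr
  | out => exact ho

/-- The rest of the computation is a premise, so runs are built backwards from their last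
configuration, in step with inductions on the words. -/
theorem regMachine_detReach_act {q : Q} {δ : (RegTape R → Symbol) → Q × (RegTape R → TapeAct)}
    (hq : prog q = actInstr δ) {f f' : R → Tape Symbol} {ti ti' tq tq' tO tO' : Tape Symbol} {q' : Q}
    {t : ℕ} {c : (regMachine prog start o).Cfg}
    (hr : OracleTM.DetReach _ O t (regCfg prog start o q' f' ti' tq' tO') c)
    (h : (δ (heads f ti tq tO)).1 = q')
    (hf : ∀ r, ((δ (heads f ti tq tO)).2 (.reg r)).apply (f r) = f' r)
    (hi : ((δ (heads f ti tq tO)).2 .inp).apply ti = ti')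
    (hqr : ((δ (heads f ti tq tO)).2 .qry).apply tq = tq')
    (ho : ((δ (heads f ti tq tO)).2 .out).apply tO = tO') :
    OracleTM.DetReach _ O (t + 1) (regCfg prog start o q f ti tq tO) c :=
  .head (regMachine_step_act hq h hf hi hqr ho) hr

/-- The state of a machine with registers, as lists: the columns of the registers and the contents
of the three stacks. -/
structure RegState (R : Type) where
  cols : List (R → Bool)
  inp : List Bool
  qry : List Bool
  out : List Bool

def stateCfg (prog : Q → Instr (RegTape R) Q) (start : Q) (o : RegTape R) (q : Q)
    (s : RegState R) : (regMachine prog start o).Cfg :=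
  regCfg prog start o q (colTape [] s.cols) (tapeAt [] s.inp) (tapeAt [] s.qry) (tapeAt [] s.out)

/-! ### Sweeps over the registers -/

/-- Move all registers to their left ends. -/
def returnInstr [Inhabited R] (self next : Q) : Instr (RegTape R) Q :=
  actInstr fun h =>
    if h (.reg default) = none then (next, onTapes (fun _ => goRight) stay stay stay)
    else (self, onTapes (fun _ => goLeft) stay stay stay)

/-- The heads start one cell to the left of `v`, where a sweep leaves them when it turns around. All
registers have the same length, so a blank in the default register marks the left end of all of
them. -/
theorem return_detReach [Inhabited R] {q q' : Q} (hq : prog q = returnInstr q q')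
    (l v : List (R → Bool)) (ti tq tO : Tape Symbol) :
    OracleTM.DetReach _ O (l.length + 1)
      (regCfg prog start o q (fun r => (colTape l v r).move .left) ti tq tO)
      (regCfg prog start o q' (colTape [] (l.reverse ++ v)) ti tq tO) := by
  induction l generalizing v with
  | nil => refine regMachine_detReach_act hq (.refl _ _) ?_ ?_ ?_ ?_ ?_ <;> simp [heads, onTapes]
  | cons c l ih =>
    refine regMachine_detReach_act hq (by simpa using ih (c :: v)) ?_ ?_ ?_ ?_ ?_ <;>
      simp [heads, onTapes]

end OracleComplexity

namespace OracleComplexity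

open Turing

variable {R Q Λ : Type}

/-! ### Instructions for machines with registers -/

/-- Instructions, with labels from `Λ` for the next instruction. -/
inductive RegInstr (R Λ : Type)
  /-- Pass over the columns from left to right with a carry bit that is initially `false` and
  change them; the final carry selects the next instruction. -/
  | map (g : Bool → (R → Bool) → Bool × (R → Bool)) (next : Bool → Λ)
  /-- Move bits from the input to the register `r`. -/
  | load (r : R) (next : Λ)
  /-- Fill the register `r` with arbitrary bits. -/
  | guess (r : R) (next : Λ)
  /-- Add to the register `y` the image of the register `x` under the matrix on the input tape. -/
  | image (x y : R) (next : Λ)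
  /-- Push a word that is composed of at most one bit for every column. -/
  | emit (toOut : Bool) (f : (R → Bool) → Option Bool) (next : Λ)
  /-- Push the contents of the input tape onto the query tape. -/
  | emitInput (next : Λ)
  | push (toOut : Bool) (b : Bool) (next : Λ)
  /-- Query the oracle, and erase the query tape. -/
  | ask (yes no : Λ)
  | halt (v : Bool)

/-- The control states for the execution of one instruction. -/
inductive Phase
  | run
  | sweep (c : Bool)
  | back (c : Bool)
  | choose
  | write (b : Bool)
  | row
  | inner
  | innerBack
  | rewindReg
  | rewindInp
  deriving Fintype

/-- The bits under the heads of the registers. -/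
def bits (h : RegTape R → Symbol) (r : R) : Bool := (h (.reg r)).getD false

@[simp]
theorem bits_onTapes (a : R → Bool) (x y z : Symbol) :
    bits (onTapes (fun r => some (a r)) x y z) = a := rfl

def jump (q : Q) : Instr (RegTape R) Q :=
  actInstr fun _ => (q, onTapes (fun _ => stay) stay stay stay)

/-- The action `a` on the output tape or the query tape. -/
def onStack (toOut : Bool) (f : R → TapeAct) (i : TapeAct) (a : TapeAct) : RegTape R → TapeAct :=
  onTapes f i (if toOut then stay else a) (if toOut then a else stay)

/-- Write the instruction as a program with states `self p`, where the next instruction begins in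
state `go l`. -/
def RegInstr.code [DecidableEq R] [Inhabited R] (self : Phase → Q) (go : Λ → Q) :
    RegInstr R Λ → Phase → Instr (RegTape R) Q
  | .map _ _, .run => jump (self (.sweep false))
  | .map g _, .sweep c => actInstr fun h =>
      if h (.reg default) = none then
        (self (.back c), onTapes (fun _ => goLeft) stay stay stay)
      else
        (self (.sweep (g c (bits h)).1),
          onTapes (fun r => putRight ((g c (bits h)).2 r)) stay stay stay)
  | .map _ next, .back c => returnInstr (self (.back c)) (go (next c))
  | .load _ _, .run => jump (self (.sweep false))
  | .load r _, .sweep _ => actInstr fun h =>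
      if h (.reg default) = none then
        (self (.back false), onTapes (fun _ => goLeft) stay stay stay)
      else
        (self (.sweep false),
          onTapes (fun r' => if r' = r then putRight ((h .inp).getD false) else goRight)
            erase stay stay)
  | .load _ next, .back _ => returnInstr (self (.back false)) (go next)
  | .guess _ _, .run => jump (self (.sweep false))
  | .guess _ _, .sweep _ => actInstr fun h =>
      if h (.reg default) = none then
        (self (.back false), onTapes (fun _ => goLeft) stay stay stay)
      else
        (self .choose, onTapes (fun _ => stay) stay stay stay)
  | .guess _ _, .choose => .guess (self (.write false)) (self (.write true))
  | .guess r _, .write b => actInstr fun _ =>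
      (self (.sweep false),
        onTapes (fun r' => if r' = r then putRight b else goRight) stay stay stay)
  | .guess _ next, .back _ => returnInstr (self (.back false)) (go next)
  | .image _ _ _, .run => jump (self .row)
  | .image x _ _, .row => actInstr fun h =>
      if h (.reg x) = none then
        (self .rewindReg, onTapes (fun r => if r = x then goLeft else stay) goLeft stay stay)
      else
        (self .inner, onTapes (fun _ => stay) stay stay stay)
  | .image x y _, .inner => actInstr fun h =>
      if h (.reg y) = none then
        (self .innerBack, onTapes (fun r => if r = y then goLeft else stay) stay stay stay)
      else
        (self .inner,
          onTapes (fun r => if r = y then putRight (bits h y || (bits h x && (h .inp).getD false))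
            else stay) (if h .inp = none then stay else goRight) stay stay)
  | .image x y _, .innerBack => actInstr fun h =>
      if h (.reg y) = none then
        (self .row, onTapes (fun r => if r = y ∨ r = x then goRight else stay) stay stay stay)
      else
        (self .innerBack, onTapes (fun r => if r = y then goLeft else stay) stay stay stay)
  | .image x _ _, .rewindReg => actInstr fun h =>
      if h (.reg x) = none then
        (self .rewindInp, onTapes (fun r => if r = x then goRight else stay) stay stay stay)
      else
        (self .rewindReg, onTapes (fun r => if r = x then goLeft else stay) stay stay stay)
  | .image _ _ next, .rewindInp => actInstr fun h =>
      if h .inp = none then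
        (go next, onTapes (fun _ => stay) goRight stay stay)
      else
        (self .rewindInp, onTapes (fun _ => stay) goLeft stay stay)
  | .emit _ _ _, .run => jump (self (.sweep false))
  | .emit k _ _, .sweep _ => actInstr fun h =>
      if h (.reg default) = none then
        (self (.back false), onStack k (fun _ => goLeft) stay goLeft)
      else
        (self (.sweep false), onStack k (fun _ => goRight) stay stay)
  | .emit k f next, .back _ => actInstr fun h =>
      if h (.reg default) = none then
        (go next, onStack k (fun _ => goRight) stay goRight)
      else
        (self (.back false), onStack k (fun _ => goLeft) stay ((f (bits h)).elim stay putLeft))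
  | .emitInput _, .run => jump (self (.sweep false))
  | .emitInput _, .sweep _ => actInstr fun h =>
      if h .inp = none then
        (self (.back false), onTapes (fun _ => stay) goLeft goLeft stay)
      else
        (self (.sweep false), onTapes (fun _ => stay) goRight stay stay)
  | .emitInput next, .back _ => actInstr fun h =>
      if h .inp = none then
        (go next, onTapes (fun _ => stay) goRight goRight stay)
      else
        (self (.back false), onTapes (fun _ => stay) goLeft (putLeft ((h .inp).getD false)) stay)
  | .push k _ _, .run => actInstr fun _ => (self (.back false), onStack k (fun _ => stay) stay goLeft)
  | .push k b next, .back _ => actInstr fun _ => (go next, onStack k (fun _ => stay) stay (put b))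
  | .ask _ _, .run => .query (self (.back true)) (self (.back false))
  | .ask yes no, .back a => actInstr fun h =>
      if h .qry = none then
        (go (if a then yes else no), onTapes (fun _ => stay) stay stay stay)
      else
        (self (.back a), onTapes (fun _ => stay) stay erase stay)
  | .halt v, .run => .halt v
  -- Phases that the instruction never enters.
  | _, _ => .halt false

/-! ### The effect of the instructions -/

/-- Pass over a list of columns with a carry bit. -/
def mealy (g : Bool → (R → Bool) → Bool × (R → Bool)) :
    Bool → List (R → Bool) → Bool × List (R → Bool)
  | c, [] => (c, [])
  | c, v :: vs => ((mealy g (g c v).1 vs).1, (g c v).2 :: (mealy g (g c v).1 vs).2)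

/-- Set the register `r` to the word `w`, which is extended by `false` where necessary. -/
def setReg [DecidableEq R] (r : R) : List Bool → List (R → Bool) → List (R → Bool)
  | _, [] => []
  | w, v :: vs => Function.update v r (w.headD false) :: setReg r w.tail vs

/-- Add the beginning of `m` to `ys` if `x` is set. -/
def rowOr (x : Bool) : List Bool → List Bool → List Bool
  | _, [] => []
  | m, y :: ys => (y || (x && m.headD false)) :: rowOr x m.tail ys

/-- Add to `ys` the image of `xs` under the matrix with rows of the length of `ys` that are the
consecutive pieces of `m`. -/
def imageOr : List Bool → List Bool → List Bool → List Bool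
  | [], _, ys => ys
  | x :: xs, m, ys => imageOr xs (m.drop ys.length) (rowOr x m ys)

def RegState.pushOn (s : RegState R) (toOut : Bool) (w : List Bool) : RegState R :=
  { s with
    qry := if toOut then s.qry else w ++ s.qry
    out := if toOut then w ++ s.out else s.out }

open Classical in
/-- The effect of an instruction without guesses that does not halt. -/
noncomputable def RegInstr.exec [DecidableEq R] (O : Set (List Bool)) :
    RegInstr R Λ → RegState R → Option (Λ × RegState R)
  | .map g next, s =>
      some (next (mealy g false s.cols).1, { s with cols := (mealy g false s.cols).2 })
  | .load r next, s =>
      some (next, { s with cols := setReg r s.inp s.cols, inp := s.inp.drop s.cols.length })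
  | .guess _ _, _ => none
  | .image x y next, s =>
      if x = y then none else
      some (next,
        { s with cols := setReg y (imageOr (s.cols.map (· x)) s.inp (s.cols.map (· y))) s.cols })
  | .emit k f next, s => some (next, s.pushOn k (s.cols.filterMap f))
  | .emitInput next, s => some (next, s.pushOn false s.inp)
  | .push k b next, s => some (next, s.pushOn k [b])
  | .ask yes no, s => some (if s.qry ∈ O then yes else no, { s with qry := [] })
  | .halt _, _ => none

/-- The output is not counted: no instruction traverses it, so running times do not depend on its
length. -/
def RegState.size (s : RegState R) : ℕ := s.cols.length + s.inp.length + s.qry.length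

/-- A bound for the number of steps that one instruction takes. -/
def RegState.cost (s : RegState R) : ℕ := 10 * (s.size + 1) ^ 2

theorem colTape_update [DecidableEq R] {l v : List (R → Bool)} {a : R → Bool} {r : R} {b : Bool} (r' : R) :
    (if r' = r then putRight b else goRight).apply (colTape l (a :: v) r') =
      colTape (Function.update a r b :: l) v r' := by
  by_cases h : r' = r
  · subst h
    simp [colTape]
  · simp [colTape, h]

theorem rowOr_length (x : Bool) (m ys : List Bool) : (rowOr x m ys).length = ys.length := by
  induction ys generalizing m with
  | nil => rfl
  | cons y ys ih => simp [rowOr, ih]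

theorem imageOr_length (xs m ys : List Bool) : (imageOr xs m ys).length = ys.length := by
  induction xs generalizing m ys with
  | nil => rfl
  | cons x xs ih => simp [imageOr, ih, rowOr_length]

theorem setReg_map_of_ne [DecidableEq R] {r r' : R} (h : r' ≠ r) (w : List Bool) (v : List (R → Bool)) :
    (setReg r w v).map (· r') = v.map (· r') := by
  induction v generalizing w with
  | nil => rfl
  | cons a v ih => simp [setReg, ih, h]

theorem setReg_map [DecidableEq R] {r : R} {w : List Bool} {v : List (R → Bool)} (h : w.length = v.length) :
    (setReg r w v).map (· r) = w := by
  induction v generalizing w with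
  | nil => simpa [setReg, eq_comm] using h
  | cons a v ih =>
    obtain ⟨b, w, rfl⟩ := List.exists_cons_of_length_eq_add_one h
    simp [setReg, ih (w := w) (by simpa using h)]

/-- The register tapes, except that the tape of `x` is `tx` and the tape of `y` is `ty`. -/
def twoTapes [DecidableEq R] (f : R → Tape Symbol) (x y : R) (tx ty : Tape Symbol) : R → Tape Symbol :=
  fun r => if r = x then tx else if r = y then ty else f r

theorem twoTapes_colTape [DecidableEq R] {x y : R} (hxy : x ≠ y) {v : List (R → Bool)} {w : List Bool}
    (h : w.length = v.length) :
    twoTapes (colTape [] v) x y (tapeAt [] (v.map (· x))) (tapeAt [] w) =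
      colTape [] (setReg y w v) := by
  funext r
  by_cases h1 : r = x
  · subst h1
    simp [twoTapes, colTape, setReg_map_of_ne hxy]
  · by_cases h2 : r = y
    · subst h2
      simp [twoTapes, colTape, setReg_map h, h1]
    · simp [twoTapes, colTape, setReg_map_of_ne h2, h1, h2]

section

variable [Fintype R] [DecidableEq R] [Fintype Q] {prog : Q → Instr (RegTape R) Q}
  {start : Q} {o : RegTape R} {O : Set (List Bool)} {self : Phase → Q} {go : Λ → Q}

theorem jump_detReach {q q' : Q} (hq : prog q = jump q') {f : R → Tape Symbol}
    {ti tq tO : Tape Symbol} {t : ℕ} {c : (regMachine prog start o).Cfg}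
    (hr : OracleTM.DetReach _ O t (regCfg prog start o q' f ti tq tO) c) :
    OracleTM.DetReach _ O (t + 1) (regCfg prog start o q f ti tq tO) c := by
  refine regMachine_detReach_act hq hr ?_ ?_ ?_ ?_ ?_ <;> simp [onTapes]

variable [Inhabited R]

/-- The columns in `l` have already been changed. The time consists of one step for each column of
`v`, one to turn around at the blank, and the way back over all columns. -/
theorem map_detReach {g : Bool → (R → Bool) → Bool × (R → Bool)} {next : Bool → Λ}
    (hp : ∀ p, prog (self p) = (RegInstr.map g next).code self go p) (c : Bool)
    (l v : List (R → Bool)) (ti tq tO : Tape Symbol) :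
    OracleTM.DetReach _ O (l.length + 2 * v.length + 2)
      (regCfg prog start o (self (.sweep c)) (colTape l v) ti tq tO)
      (regCfg prog start o (go (next (mealy g c v).1))
        (colTape [] (l.reverse ++ (mealy g c v).2)) ti tq tO) := by
  induction v generalizing l c with
  | nil =>
    refine regMachine_detReach_act (hp (.sweep c)) (return_detReach (hp (.back c)) l [] ti tq tO)
      ?_ ?_ ?_ ?_ ?_ <;> simp [heads, onTapes]
  | cons a v ih =>
    have := ih (g c a).1 ((g c a).2 :: l)
    refine (regMachine_detReach_act (hp (.sweep c)) (by simpa [mealy] using this)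
      ?_ ?_ ?_ ?_ ?_).mono (by simp; omega) <;> simp [heads, onTapes]

theorem load_detReach {r : R} {next : Λ}
    (hp : ∀ p, prog (self p) = (RegInstr.load r next).code self go p)
    (l v : List (R → Bool)) (w : List Bool) (tq tO : Tape Symbol) :
    OracleTM.DetReach _ O (l.length + 2 * v.length + 2)
      (regCfg prog start o (self (.sweep false)) (colTape l v) (tapeAt [] w) tq tO)
      (regCfg prog start o (go next)
        (colTape [] (l.reverse ++ setReg r w v)) (tapeAt [] (w.drop v.length)) tq tO) := by
  induction v generalizing l w with
  | nil =>
    refine regMachine_detReach_act (hp (.sweep false))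
      (return_detReach (hp (.back false)) l [] (tapeAt [] w) tq tO)
      ?_ ?_ ?_ ?_ ?_ <;> simp [heads, onTapes]
  | cons a v ih =>
    have := ih (Function.update a r (w.headD false) :: l) w.tail
    -- An exhausted input is read as `false`, which is the padding in `setReg`.
    have hh : (tapeAt [] w).head.getD false = w.headD false := by cases w <;> rfl
    refine (regMachine_detReach_act (hp (.sweep false)) (by simpa [setReg] using this)
      ?_ ?_ ?_ ?_ ?_).mono (by simp; omega) <;> simp [heads, onTapes, hh, colTape_update]

/-- The bits are guessed column by column. Once a bit `b` is written, what remains is the claim for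
`fun w => A (b :: w)`, so the induction varies `A`. A column costs three steps on the way out and
one on the way back. -/
theorem guess_decides {r : R} {next : Λ}
    (hp : ∀ p, prog (self p) = (RegInstr.guess r next).code self go p)
    (l v : List (R → Bool)) (ti tq tO : Tape Symbol) {T : ℕ} {A : List Bool → Prop}
    (h : ∀ w : List Bool, w.length = v.length → OracleTM.Decides _ O
      (regCfg prog start o (go next) (colTape [] (l.reverse ++ setReg r w v)) ti tq tO) T (A w)) :
    OracleTM.Decides _ O (regCfg prog start o (self (.sweep false)) (colTape l v) ti tq tO)
      (T + (l.length + 4 * v.length + 2)) (∃ w : List Bool, w.length = v.length ∧ A w) := by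
  induction v generalizing l A with
  | nil =>
    have h0 := (h [] rfl).congr (B := ∃ w : List Bool, w.length = 0 ∧ A w) (by simp)
    refine (OracleTM.Decides.of_detReach (regMachine_detReach_act (hp (.sweep false))
      (return_detReach (hp (.back false)) l [] ti tq tO) ?_ ?_ ?_ ?_ ?_) h0).mono
        (by simp; omega) <;> simp [heads, onTapes]
  | cons a v ih =>
    have h1 : ∀ b : Bool, OracleTM.Decides _ O
        (regCfg prog start o (self (.write b)) (colTape l (a :: v)) ti tq tO)
        (T + (l.length + 4 * v.length + 4)) (∃ w : List Bool, w.length = v.length ∧ A (b :: w)) := by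
      intro b
      have h2 := ih (Function.update a r b :: l) (A := fun w => A (b :: w)) (fun w hw => by
        simpa [setReg] using h (b :: w) (by simp [hw]))
      refine (OracleTM.Decides.of_detReach (regMachine_detReach_act (hp (.write b))
        (.refl 0 _) ?_ ?_ ?_ ?_ ?_) h2).mono (by simp; omega) <;>
        simp [onTapes, colTape_update]
    have h3 : OracleTM.Decides _ O (regCfg prog start o (self .choose) (colTape l (a :: v)) ti tq tO)
        (T + (l.length + 4 * v.length + 4) + 1)
        (∃ b : Bool, ∃ w : List Bool, w.length = v.length ∧ A (b :: w)) := by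
      refine OracleTM.Decides.step
        (c' := fun b => regCfg prog start o (self (.write b)) (colTape l (a :: v)) ti tq tO) ?_ h1
      intro b
      have hq : (regMachine prog start o).prog
          (regCfg prog start o (self .choose) (colTape l (a :: v)) ti tq tO).state =
          .guess (self (.write false)) (self (.write true)) := hp .choose
      rw [OracleTM.step, hq]
      cases b <;> rfl
    refine ((OracleTM.Decides.of_detReach (regMachine_detReach_act (hp (.sweep false))
      (.refl 0 _) ?_ ?_ ?_ ?_ ?_) h3).mono (by simp; omega)).congr ?_
    · simp [heads, onTapes]
    · simp [heads, onTapes]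
    · simp [heads, onTapes]
    · simp [heads, onTapes]
    · simp [heads, onTapes]
    · constructor
      · rintro ⟨b, w, hw, hA⟩
        exact ⟨b :: w, by simp [hw], hA⟩
      · rintro ⟨w, hw, hA⟩
        obtain ⟨b, w, rfl⟩ := List.exists_cons_of_length_eq_add_one hw
        exact ⟨b, w, by simpa using hw, hA⟩

/-- A stack receives its last bit first, so the heads run to the right end before anything is
pushed. At the turn the head of the stack steps onto the blank left of its top. -/
theorem emit_sweep_detReach {k : Bool} {f : (R → Bool) → Option Bool} {next : Λ}
    (hp : ∀ p, prog (self p) = (RegInstr.emit k f next).code self go p)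
    (l v : List (R → Bool)) (ti tq tO : Tape Symbol) :
    OracleTM.DetReach _ O (v.length + 1)
      (regCfg prog start o (self (.sweep false)) (colTape l v) ti tq tO)
      (regCfg prog start o (self (.back false)) (fun r => (colTape (v.reverse ++ l) [] r).move .left)
        ti (if k then tq else tq.move .left) (if k then tO.move .left else tO)) := by
  induction v generalizing l with
  | nil =>
    refine regMachine_detReach_act (hp (.sweep false)) (.refl _ _) ?_ ?_ ?_ ?_ ?_ <;>
      cases k <;> simp [heads, onTapes, onStack]
  | cons a v ih =>
    refine (regMachine_detReach_act (hp (.sweep false)) (by simpa using ih (a :: l))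
      ?_ ?_ ?_ ?_ ?_).mono (by simp) <;> cases k <;> simp [heads, onTapes, onStack]

/-- Pushing while the columns are read from right to left restores their order. The head of the
stack rests on the blank left of the top until the final move to the right. -/
theorem emit_back_detReach {k : Bool} {f : (R → Bool) → Option Bool} {next : Λ}
    (hp : ∀ p, prog (self p) = (RegInstr.emit k f next).code self go p)
    (l v : List (R → Bool)) (ti : Tape Symbol) (q w : List Bool) :
    OracleTM.DetReach _ O (l.length + 1)
      (regCfg prog start o (self (.back false)) (fun r => (colTape l v r).move .left) ti
        (if k then tapeAt [] q else (tapeAt [] q).move .left)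
        (if k then (tapeAt [] w).move .left else tapeAt [] w))
      (regCfg prog start o (go next) (colTape [] (l.reverse ++ v)) ti
        (tapeAt [] (if k then q else l.reverse.filterMap f ++ q))
        (tapeAt [] (if k then l.reverse.filterMap f ++ w else w))) := by
  induction l generalizing v q w with
  | nil =>
    refine regMachine_detReach_act (hp (.back false)) (.refl _ _) ?_ ?_ ?_ ?_ ?_ <;>
      cases k <;> simp [heads, onTapes, onStack]
  | cons a l ih =>
    have := ih (a :: v) (if k then q else (f a).toList ++ q) (if k then (f a).toList ++ w else w)
    cases k <;> cases hf : f a <;>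
    refine (regMachine_detReach_act (hp (.back false)) (by simpa [hf] using this)
      ?_ ?_ ?_ ?_ ?_).mono (by simp) <;> simp [heads, onTapes, onStack, hf]

theorem emitInput_sweep_detReach {next : Λ}
    (hp : ∀ p, prog (self p) = (RegInstr.emitInput next : RegInstr R Λ).code self go p)
    (f : R → Tape Symbol) (l v : List Bool) (tq tO : Tape Symbol) :
    OracleTM.DetReach _ O (v.length + 1)
      (regCfg prog start o (self (.sweep false)) f (tapeAt l v) tq tO)
      (regCfg prog start o (self (.back false)) f ((tapeAt (v.reverse ++ l) []).move .left)
        (tq.move .left) tO) := by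
  induction v generalizing l with
  | nil =>
    refine regMachine_detReach_act (hp (.sweep false)) (.refl _ _) ?_ ?_ ?_ ?_ ?_ <;>
      simp [heads, onTapes]
  | cons a v ih =>
    refine (regMachine_detReach_act (hp (.sweep false)) (by simpa using ih (a :: l))
      ?_ ?_ ?_ ?_ ?_).mono (by simp) <;> simp [heads, onTapes]

theorem emitInput_back_detReach {next : Λ}
    (hp : ∀ p, prog (self p) = (RegInstr.emitInput next : RegInstr R Λ).code self go p)
    (f : R → Tape Symbol) (l v q : List Bool) (tO : Tape Symbol) :
    OracleTM.DetReach _ O (l.length + 1)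
      (regCfg prog start o (self (.back false)) f ((tapeAt l v).move .left)
        ((tapeAt [] q).move .left) tO)
      (regCfg prog start o (go next) f (tapeAt [] (l.reverse ++ v))
        (tapeAt [] (l.reverse ++ q)) tO) := by
  induction l generalizing v q with
  | nil =>
    refine regMachine_detReach_act (hp (.back false)) (.refl _ _) ?_ ?_ ?_ ?_ ?_ <;>
      simp [heads, onTapes]
  | cons a l ih =>
    refine (regMachine_detReach_act (hp (.back false)) (by simpa using ih (a :: v) (a :: q))
      ?_ ?_ ?_ ?_ ?_).mono (by simp) <;> simp [heads, onTapes]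

theorem ask_erase_detReach {yes no : Λ}
    (hp : ∀ p, prog (self p) = (RegInstr.ask yes no : RegInstr R Λ).code self go p) (a : Bool)
    (f : R → Tape Symbol) (ti : Tape Symbol) (q : List Bool) (tO : Tape Symbol) :
    OracleTM.DetReach _ O (q.length + 1)
      (regCfg prog start o (self (.back a)) f ti (tapeAt [] q) tO)
      (regCfg prog start o (go (if a then yes else no)) f ti (tapeAt [] []) tO) := by
  induction q with
  | nil =>
    refine regMachine_detReach_act (hp (.back a)) (.refl _ _) ?_ ?_ ?_ ?_ ?_ <;>
      simp [heads, onTapes]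
  | cons b q ih =>
    refine (regMachine_detReach_act (hp (.back a)) ih ?_ ?_ ?_ ?_ ?_).mono (by simp) <;>
      simp [heads, onTapes]

/-! #### Images under the matrix -/

/-- At the end of a row, `y` is rewound and `x` advances, while the input head stays where the next
row begins. -/
theorem image_innerBack_detReach {x y : R} {next : Λ} (hxy : x ≠ y)
    (hp : ∀ p, prog (self p) = (RegInstr.image x y next).code self go p)
    (f : R → Tape Symbol) (tx ti tq tO : Tape Symbol) (l v : List Bool) :
    OracleTM.DetReach _ O (l.length + 1)
      (regCfg prog start o (self .innerBack) (twoTapes f x y tx ((tapeAt l v).move .left)) ti tq tO)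
      (regCfg prog start o (self .row) (twoTapes f x y (tx.move .right) (tapeAt [] (l.reverse ++ v)))
        ti tq tO) := by
  induction l generalizing v with
  | nil =>
    refine regMachine_detReach_act (hp .innerBack) (.refl _ _) ?_ ?_ ?_ ?_ ?_
    case refine_2 =>
      intro r
      by_cases h1 : r = x
      · simp [heads, onTapes, twoTapes, h1, hxy.symm]
      · by_cases h2 : r = y <;> simp [heads, onTapes, twoTapes, h1, h2, hxy.symm]
    all_goals simp [heads, onTapes, twoTapes, hxy.symm]
  | cons b l ih =>
    refine (regMachine_detReach_act (hp .innerBack) (by simpa using ih (b :: v))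
      ?_ ?_ ?_ ?_ ?_).mono (by simp)
    case refine_2 =>
      intro r
      by_cases h1 : r = x
      · simp [heads, onTapes, twoTapes, h1, hxy, hxy.symm]
      · by_cases h2 : r = y <;> simp [heads, onTapes, twoTapes, h1, h2, hxy.symm]
    all_goals simp [heads, onTapes, twoTapes, hxy.symm]

/-- The register `y` and a row of the matrix are read in parallel while the head of `x` rests on the
bit `b` that belongs to this row. If the input runs out, its head stays on the blank and missing
entries count as `false`. -/
theorem image_inner_detReach {x y : R} {next : Λ} (hxy : x ≠ y)
    (hp : ∀ p, prog (self p) = (RegInstr.image x y next).code self go p)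
    (f : R → Tape Symbol) (tx tq tO : Tape Symbol) {b : Bool} (hx : tx.head = some b)
    (li m l v : List Bool) :
    OracleTM.DetReach _ O (l.length + 2 * v.length + 2)
      (regCfg prog start o (self .inner) (twoTapes f x y tx (tapeAt l v)) (tapeAt li m) tq tO)
      (regCfg prog start o (self .row)
        (twoTapes f x y (tx.move .right) (tapeAt [] (l.reverse ++ rowOr b m v)))
        (tapeAt ((m.take v.length).reverse ++ li) (m.drop v.length)) tq tO) := by
  induction v generalizing l m li with
  | nil =>
    refine (regMachine_detReach_act (hp .inner)
      (image_innerBack_detReach hxy hp f tx (tapeAt li m) tq tO l [])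
      ?_ ?_ ?_ ?_ ?_).mono (by simp)
    case refine_2 =>
      intro r
      by_cases h1 : r = x
      · simp [heads, onTapes, twoTapes, h1, hxy, hxy.symm]
      · by_cases h2 : r = y <;> simp [heads, onTapes, twoTapes, h1, h2, hxy.symm]
    all_goals simp [heads, onTapes, twoTapes, hxy.symm]
  | cons a v ih =>
    have := ih ((m.take 1).reverse ++ li) m.tail ((a || (b && m.headD false)) :: l)
    refine (regMachine_detReach_act (hp .inner) (ti' := tapeAt ((m.take 1).reverse ++ li) m.tail)
      (f' := twoTapes f x y tx (tapeAt ((a || (b && m.headD false)) :: l) v))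
      (q' := self .inner) (tq' := tq) (tO' := tO) (t := l.length + 1 + 2 * v.length + 2)
      ?_ ?_ ?_ ?_ ?_ ?_).mono (by simp; omega)
    case refine_1 => cases m <;> simpa [rowOr] using this
    case refine_3 =>
      intro r
      by_cases h1 : r = x
      · cases m <;> simp [heads, onTapes, twoTapes, h1, hxy, hxy.symm]
      · by_cases h2 : r = y <;> cases m <;>
          simp [heads, onTapes, twoTapes, h1, h2, hxy.symm, bits, hx]
    all_goals cases m <;> simp [heads, onTapes, twoTapes, hxy.symm]

/-- The position reached on the input tape is irrelevant, since the head is rewound afterwards;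
hence only the whole word formed by `l'` and `m'` is recorded. -/
theorem image_row_detReach {x y : R} {next : Λ} (hxy : x ≠ y)
    (hp : ∀ p, prog (self p) = (RegInstr.image x y next).code self go p)
    (f : R → Tape Symbol) (tq tO : Tape Symbol) (lx xs li m ys : List Bool) :
    ∃ l' m', l'.reverse ++ m' = li.reverse ++ m ∧
    OracleTM.DetReach _ O (xs.length * (2 * ys.length + 3) + 1)
      (regCfg prog start o (self .row) (twoTapes f x y (tapeAt lx xs) (tapeAt [] ys))
        (tapeAt li m) tq tO)
      (regCfg prog start o (self .rewindReg)
        (twoTapes f x y ((tapeAt (xs.reverse ++ lx) []).move .left) (tapeAt [] (imageOr xs m ys)))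
        ((tapeAt l' m').move .left) tq tO) := by
  induction xs generalizing lx li m ys with
  | nil =>
    refine ⟨li, m, rfl, (regMachine_detReach_act (hp .row) (.refl _ _) ?_ ?_ ?_ ?_ ?_)⟩
    case refine_2 =>
      intro r
      by_cases h1 : r = x
      · simp [heads, onTapes, twoTapes, h1]
      · by_cases h2 : r = y <;> simp [heads, onTapes, twoTapes, h1, h2, hxy.symm, imageOr]
    all_goals simp [heads, onTapes, twoTapes]
  | cons b xs ih =>
    obtain ⟨l', m', h1, h2⟩ := ih (b :: lx) ((m.take ys.length).reverse ++ li) (m.drop ys.length)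
      (rowOr b m ys)
    refine ⟨l', m', by simp [h1], ?_⟩
    have h3 := image_inner_detReach (O := O) (start := start) (o := o) hxy hp f
      (tapeAt lx (b :: xs)) tq tO rfl li m [] ys
    simp only [tapeAt_move_right, List.reverse_nil, List.nil_append] at h3
    refine (regMachine_detReach_act (hp .row) (h3.trans (by simpa [imageOr] using h2))
      ?_ ?_ ?_ ?_ ?_).mono (by simp [rowOr_length]; ring_nf; omega) <;>
      simp [heads, onTapes, twoTapes]

theorem image_rewindReg_detReach {x y : R} {next : Λ}
    (hp : ∀ p, prog (self p) = (RegInstr.image x y next).code self go p)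
    (f : R → Tape Symbol) (ty ti tq tO : Tape Symbol) (l v : List Bool) :
    OracleTM.DetReach _ O (l.length + 1)
      (regCfg prog start o (self .rewindReg) (twoTapes f x y ((tapeAt l v).move .left) ty) ti tq tO)
      (regCfg prog start o (self .rewindInp) (twoTapes f x y (tapeAt [] (l.reverse ++ v)) ty)
        ti tq tO) := by
  induction l generalizing v with
  | nil =>
    refine regMachine_detReach_act (hp .rewindReg) (.refl _ _) ?_ ?_ ?_ ?_ ?_
    case refine_2 =>
      intro r
      by_cases h1 : r = x <;> simp [heads, onTapes, twoTapes, h1]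
    all_goals simp [heads, onTapes, twoTapes]
  | cons b l ih =>
    refine (regMachine_detReach_act (hp .rewindReg) (by simpa using ih (b :: v))
      ?_ ?_ ?_ ?_ ?_).mono (by simp)
    case refine_2 =>
      intro r
      by_cases h1 : r = x <;> simp [heads, onTapes, twoTapes, h1]
    all_goals simp [heads, onTapes, twoTapes]

theorem image_rewindInp_detReach {x y : R} {next : Λ}
    (hp : ∀ p, prog (self p) = (RegInstr.image x y next).code self go p)
    (f : R → Tape Symbol) (tq tO : Tape Symbol) (l v : List Bool) :
    OracleTM.DetReach _ O (l.length + 1)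
      (regCfg prog start o (self .rewindInp) f ((tapeAt l v).move .left) tq tO)
      (regCfg prog start o (go next) f (tapeAt [] (l.reverse ++ v)) tq tO) := by
  induction l generalizing v with
  | nil =>
    refine regMachine_detReach_act (hp .rewindInp) (.refl _ _) ?_ ?_ ?_ ?_ ?_ <;>
      simp [heads, onTapes]
  | cons b l ih =>
    refine (regMachine_detReach_act (hp .rewindInp) (by simpa using ih (b :: v))
      ?_ ?_ ?_ ?_ ?_).mono (by simp) <;> simp [heads, onTapes]

theorem image_detReach {x y : R} {next : Λ} (hxy : x ≠ y)
    (hp : ∀ p, prog (self p) = (RegInstr.image x y next).code self go p)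
    (v : List (R → Bool)) (m : List Bool) (tq tO : Tape Symbol) :
    OracleTM.DetReach _ O (v.length * (2 * v.length + 3) + v.length + m.length + 3)
      (regCfg prog start o (self .row) (colTape [] v) (tapeAt [] m) tq tO)
      (regCfg prog start o (go next)
        (colTape [] (setReg y (imageOr (v.map (· x)) m (v.map (· y))) v))
        (tapeAt [] m) tq tO) := by
  have h0 : colTape [] v =
      twoTapes (colTape [] v) x y (tapeAt [] (v.map (· x))) (tapeAt [] (v.map (· y))) := by
    funext r
    by_cases h1 : r = x
    · simp [twoTapes, colTape, h1]
    · by_cases h2 : r = y <;> simp [twoTapes, colTape, h1, h2, hxy.symm]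
  obtain ⟨l', m', h1, h2⟩ := image_row_detReach (O := O) (start := start) (o := o) hxy hp
    (colTape [] v) tq tO [] (v.map (· x)) [] m (v.map (· y))
  have h3 := h2.trans ((image_rewindReg_detReach hp (colTape [] v) _ _ tq tO _ []).trans
    (image_rewindInp_detReach hp _ tq tO l' m'))
  rw [← h0] at h3
  simp only [List.append_nil, List.reverse_reverse] at h3
  rw [twoTapes_colTape hxy (by simp [imageOr_length]), h1] at h3
  -- The input head has moved at most to the end of the matrix, which bounds the time for rewinding
  -- it.
  have hl : l'.length ≤ m.length := by
    have := congrArg List.length h1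
    simp at this
    omega
  exact h3.mono (by simp; omega)

/-- An instruction without guesses that does not halt has its effect within the cost bound. -/
theorem exec_detReach {ins : RegInstr R Λ} (hp : ∀ p, prog (self p) = ins.code self go p)
    {s s' : RegState R} {l : Λ} (h : ins.exec O s = some (l, s')) :
    OracleTM.DetReach _ O s.cost (stateCfg prog start o (self .run) s)
      (stateCfg prog start o (go l) s') := by
  -- A bound linear in the size is enough for all instructions but `image`, which passes over the
  -- register `y` once for every bit of `x`.
  have hc : 10 * s.size + 10 ≤ s.cost := by
    rw [RegState.cost]
    nlinarith [Nat.zero_le s.size]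
  have hc' : 10 * s.size * s.size + 10 * s.size + 10 ≤ s.cost := by
    rw [RegState.cost]
    nlinarith [Nat.zero_le s.size]
  have hs : s.size = s.cols.length + s.inp.length + s.qry.length := rfl
  cases ins with
  | map g next =>
    obtain ⟨rfl, rfl⟩ : _ ∧ _ := by simpa [RegInstr.exec] using h
    exact (jump_detReach (hp .run) (map_detReach hp false [] s.cols _ _ _)).mono (by simp; omega)
  | load r next =>
    obtain ⟨rfl, rfl⟩ : _ ∧ _ := by simpa [RegInstr.exec] using h
    exact (jump_detReach (hp .run) (load_detReach hp [] s.cols _ _ _)).mono (by simp; omega)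
  | guess r next => simp [RegInstr.exec] at h
  | image x y next =>
    by_cases hxy : x = y
    · simp [RegInstr.exec, hxy] at h
    · obtain ⟨rfl, rfl⟩ : _ ∧ _ := by simpa [RegInstr.exec, hxy] using h
      refine (jump_detReach (hp .run) (image_detReach hxy hp s.cols _ _ _)).mono ?_
      have : s.cols.length * s.cols.length ≤ s.size * s.size :=
        Nat.mul_le_mul (by omega) (by omega)
      nlinarith
  | emit k f next =>
    obtain ⟨rfl, rfl⟩ : _ ∧ _ := by simpa [RegInstr.exec] using h
    have h1 := emit_sweep_detReach (O := O) (start := start) (o := o) hp [] s.cols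
      (tapeAt [] s.inp) (tapeAt [] s.qry) (tapeAt [] s.out)
    have h2 := emit_back_detReach (O := O) (start := start) (o := o) hp s.cols.reverse []
      (tapeAt [] s.inp) s.qry s.out
    simp only [List.append_nil, List.reverse_reverse] at h1 h2
    refine (jump_detReach (hp .run) (h1.trans h2)).mono (by simp; omega)
  | emitInput next =>
    obtain ⟨rfl, rfl⟩ : _ ∧ _ := by simpa [RegInstr.exec] using h
    have h1 := emitInput_sweep_detReach (O := O) (start := start) (o := o) hp (colTape [] s.cols) []
      s.inp (tapeAt [] s.qry) (tapeAt [] s.out)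
    have h2 := emitInput_back_detReach (O := O) (start := start) (o := o) hp (colTape [] s.cols)
      s.inp.reverse [] s.qry (tapeAt [] s.out)
    simp only [List.append_nil, List.reverse_reverse] at h1 h2
    refine (jump_detReach (hp .run) (h1.trans h2)).mono (by simp; omega)
  | push k b next =>
    obtain ⟨rfl, rfl⟩ : _ ∧ _ := by simpa [RegInstr.exec] using h
    have h2 : OracleTM.DetReach _ O 1
        (regCfg prog start o (self (.back false)) (colTape [] s.cols) (tapeAt [] s.inp)
          (if k then tapeAt [] s.qry else (tapeAt [] s.qry).move .left)
          (if k then (tapeAt [] s.out).move .left else tapeAt [] s.out))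
        (stateCfg prog start o (go next) (s.pushOn k [b])) := by
      refine regMachine_detReach_act (hp (.back false)) (.refl _ _) ?_ ?_ ?_ ?_ ?_ <;>
        cases k <;> simp [onTapes, onStack, RegState.pushOn]
    refine (regMachine_detReach_act (hp .run) h2 ?_ ?_ ?_ ?_ ?_).mono (by omega) <;>
      cases k <;> simp [onTapes, onStack]
  | ask yes no =>
    obtain ⟨rfl, rfl⟩ : _ ∧ _ := by simpa [RegInstr.exec] using h
    classical
    have h1 := ask_erase_detReach (O := O) (start := start) (o := o) hp (decide (s.qry ∈ O))
      (colTape [] s.cols) (tapeAt [] s.inp) s.qry (tapeAt [] s.out)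
    simp only [decide_eq_true_eq] at h1
    refine (OracleTM.DetReach.head (fun _ => ?_) h1).mono (by omega)
    have hq : (regMachine prog start o).prog (stateCfg prog start o (self .run) s).state =
        .query (self (.back true)) (self (.back false)) := hp .run
    rw [OracleTM.step, hq]
    have hw : readWord ((stateCfg prog start o (self .run) s).tape
        (regMachine prog start o).queryTape) = s.qry := readWord_wordTape _
    simp only [hw]
    by_cases hO : s.qry ∈ O <;> simp [hO] <;> rfl
  | halt v => simp [RegInstr.exec] at h

end

end OracleComplexity

namespace OracleComplexity

open Turing Polynomial

variable {R Q Λ : Type}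

/-! ### Reading the input -/

/-- The control states in which the input is read. -/
inductive Prelude
  | sign
  | unary (s : Bool)
  | rewind (s : Bool)
  | columns
  | ret
  deriving Fintype

/-- Read (and erase) a literal, which is stored as a singleton in the register `lit s` for its
sign `s`, then a word `1ⁿ0`, which creates `n` columns. -/
def preludeCode [DecidableEq R] [Inhabited R] (lit : Bool → R) (self : Prelude → Q) (go : Q) :
    Prelude → Instr (RegTape R) Q
  | .sign => actInstr fun h =>
      (self (.unary ((h .inp).getD false)), onTapes (fun _ => stay) erase stay stay)
  | .unary s => actInstr fun h =>
      if h .inp = some true then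
        (self (.unary s),
          onTapes (fun r => if r = lit s then putRight false else stay) erase stay stay)
      else
        (self (.rewind s),
          onTapes (fun r => if r = lit s then putLeft true else stay) erase stay stay)
  | .rewind s => actInstr fun h =>
      if h (.reg (lit s)) = none then
        (self .columns, onTapes (fun r => if r = lit s then goRight else stay) stay stay stay)
      else
        (self (.rewind s), onTapes (fun r => if r = lit s then goLeft else stay) stay stay stay)
  | .columns => actInstr fun h =>
      if h .inp = some true then
        (self .columns, onTapes (fun r => putRight (bits h r)) erase stay stay)
      else
        (self .ret, onTapes (fun _ => goLeft) erase stay stay)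
  | .ret => returnInstr (self .ret) go

/-- `n` columns that hold the words `u r`. -/
def padCols : ℕ → (R → List Bool) → List (R → Bool)
  | 0, _ => []
  | n + 1, u => (fun r => (u r).headD false) :: padCols n fun r => (u r).tail

theorem padCols_eq_ofFn (n : ℕ) (u : R → List Bool) :
    padCols n u = List.ofFn fun (j : Fin n) r => (u r).getD j false := by
  induction n generalizing u with
  | zero => rfl
  | succ n ih =>
    rw [padCols, ih, List.ofFn_succ]
    congr 1
    · funext r
      cases u r <;> rfl
    · congr 1
      funext j r
      cases u r <;> simp

/-- The number of bits `1` at the beginning of a word. -/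
def unaryLength (w : List Bool) : ℕ := (w.takeWhile id).length

/-- What is left of a word without its initial `1ⁿ0`. -/
def unaryRest (w : List Bool) : List Bool := (w.dropWhile id).tail

section

variable [Fintype R] [DecidableEq R] [Fintype Q] [Inhabited R] {prog : Q → Instr (RegTape R) Q}
  {start : Q} {o : RegTape R} {O : Set (List Bool)} {lit : Bool → R} {self : Prelude → Q} {go : Q}

theorem columns_stop_detReach (hp : ∀ p, prog (self p) = preludeCode lit self go p)
    {w : List Bool} (hw : (tapeAt [] w).head ≠ some true) (l : List (R → Bool))
    (tq tO : Tape Symbol) :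
    OracleTM.DetReach _ O (l.length + 2)
      (regCfg prog start o (self .columns) (fun r => tapeAt (l.map (· r)) []) (tapeAt [] w) tq tO)
      (regCfg prog start o go (colTape [] (l.reverse ++ [])) (tapeAt [] w.tail) tq tO) := by
  refine regMachine_detReach_act (hp .columns)
    (return_detReach (hp .ret) l [] (tapeAt [] w.tail) tq tO) ?_ ?_ ?_ ?_ ?_ <;>
    simp [heads, onTapes, hw, colTape]

/-- A register may already hold a word `u r`, the literal. Its bits are written back and blanks
become `false`, so all registers end up equally long; by `hu` no word reaches beyond the columns. -/
theorem columns_detReach (hp : ∀ p, prog (self p) = preludeCode lit self go p)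
    (w : List Bool) (l : List (R → Bool)) (u : R → List Bool)
    (hu : ∀ r, (u r).length ≤ unaryLength w) (tq tO : Tape Symbol) :
    OracleTM.DetReach _ O (l.length + 2 * unaryLength w + 2)
      (regCfg prog start o (self .columns) (fun r => tapeAt (l.map (· r)) (u r)) (tapeAt [] w) tq tO)
      (regCfg prog start o go (colTape [] (l.reverse ++ padCols (unaryLength w) u))
        (tapeAt [] (unaryRest w)) tq tO) := by
  induction w generalizing l u with
  | nil =>
    obtain rfl : u = fun _ => [] := funext fun r => by simpa [unaryLength] using hu r
    exact columns_stop_detReach hp (by simp) l tq tO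
  | cons b w ih =>
    cases b with
    | false =>
      obtain rfl : u = fun _ => [] := funext fun r => by simpa [unaryLength] using hu r
      exact columns_stop_detReach hp (by simp) l tq tO
    | true =>
      have hn : unaryLength (true :: w) = unaryLength w + 1 := by simp [unaryLength]
      have hr : unaryRest (true :: w) = unaryRest w := by simp [unaryRest]
      have := ih ((fun r => (u r).headD false) :: l) (fun r => (u r).tail)
        (fun r => by have := hu r; rw [hn] at this; simp; omega)
      rw [hn, hr]
      refine (regMachine_detReach_act (hp .columns) (by simpa [padCols] using this)
        ?_ ?_ ?_ ?_ ?_).mono (by simp; omega)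
      case refine_2 =>
        intro r
        cases hur : u r <;> simp [heads, onTapes, bits, hur]
      all_goals simp [heads, onTapes]

theorem rewind_detReach (hp : ∀ p, prog (self p) = preludeCode lit self go p) (s : Bool)
    (l v : List Bool) (f : R → Tape Symbol) (ti tq tO : Tape Symbol) :
    OracleTM.DetReach _ O (l.length + 1)
      (regCfg prog start o (self (.rewind s)) (Function.update f (lit s) ((tapeAt l v).move .left))
        ti tq tO)
      (regCfg prog start o (self .columns) (Function.update f (lit s) (tapeAt [] (l.reverse ++ v)))
        ti tq tO) := by
  induction l generalizing v with
  | nil =>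
    refine regMachine_detReach_act (hp (.rewind s)) (.refl _ _) ?_ ?_ ?_ ?_ ?_
    case refine_2 =>
      intro r
      by_cases h1 : r = lit s <;> simp [heads, onTapes, h1]
    all_goals simp [heads, onTapes]
  | cons b l ih =>
    refine (regMachine_detReach_act (hp (.rewind s)) (by simpa using ih (b :: v))
      ?_ ?_ ?_ ?_ ?_).mono (by simp)
    case refine_2 =>
      intro r
      by_cases h1 : r = lit s <;> simp [heads, onTapes, h1]
    all_goals simp [heads, onTapes]

/-- The number `1ᵃ0` becomes `0ᵃ1`, the beginning of the characteristic word of `{a}`; the padding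
is added when the columns are created. -/
theorem unary_detReach (hp : ∀ p, prog (self p) = preludeCode lit self go p) (s : Bool)
    (a : ℕ) (l w : List Bool) (f : R → Tape Symbol) (tq tO : Tape Symbol) :
    OracleTM.DetReach _ O (l.length + 2 * a + 2)
      (regCfg prog start o (self (.unary s)) (Function.update f (lit s) (tapeAt l []))
        (tapeAt [] (List.replicate a true ++ false :: w)) tq tO)
      (regCfg prog start o (self .columns)
        (Function.update f (lit s) (tapeAt [] (l.reverse ++ (List.replicate a false ++ [true]))))
        (tapeAt [] w) tq tO) := by
  induction a generalizing l with
  | zero =>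
    refine regMachine_detReach_act (hp (.unary s))
      (rewind_detReach hp s l [true] f (tapeAt [] w) tq tO) ?_ ?_ ?_ ?_ ?_
    case refine_2 =>
      intro r
      by_cases h1 : r = lit s <;> simp [heads, onTapes, h1]
    all_goals simp [heads, onTapes]
  | succ a ih =>
    refine (regMachine_detReach_act (hp (.unary s))
      (by simpa [List.replicate_succ] using ih (false :: l)) ?_ ?_ ?_ ?_ ?_).mono (by simp; omega)
    case refine_2 =>
      intro r
      by_cases h1 : r = lit s <;> simp [heads, onTapes, h1, List.replicate_succ]
    all_goals simp [heads, onTapes, List.replicate_succ]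

end

/-! ### Programs -/

/-- The program with the given instructions that begins with the instruction `l₀`. -/
def regProg [DecidableEq R] [Inhabited R] (code : Λ → RegInstr R Λ) (l₀ : Λ) (lit : Bool → R) :
    Prelude ⊕ (Λ × Phase) → Instr (RegTape R) (Prelude ⊕ (Λ × Phase))
  | .inl p => preludeCode lit .inl (.inr (l₀, .run)) p
  | .inr (l, p) => (code l).code (fun p => .inr (l, p)) (fun l => .inr (l, .run)) p

section

variable [Fintype R] [DecidableEq R] [Inhabited R] [Fintype Λ]

/-- The machine that reads its input from the state `p` on and then executes the instructions. -/
abbrev progMachine (code : Λ → RegInstr R Λ) (l₀ : Λ) (lit : Bool → R) (p : Prelude)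
    (o : RegTape R) : OracleTM :=
  regMachine (regProg code l₀ lit) (.inl p) o

/-- The configuration at the beginning of the instruction `l`. -/
abbrev progCfg (code : Λ → RegInstr R Λ) (l₀ : Λ) (lit : Bool → R) (p : Prelude)
    (o : RegTape R) (l : Λ) (s : RegState R) : (progMachine code l₀ lit p o).Cfg :=
  stateCfg (regProg code l₀ lit) (.inl p) o (.inr (l, .run)) s

variable {code : Λ → RegInstr R Λ} {l₀ : Λ} {lit : Bool → R} {p : Prelude} {o : RegTape R}
  {O : Set (List Bool)}

theorem progMachine_init (w : List Bool) :
    (progMachine code l₀ lit p o).init w =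
      regCfg (regProg code l₀ lit) (.inl p) o (.inl p) (fun _ => tapeAt [] []) (tapeAt [] w)
        (tapeAt [] []) (tapeAt [] []) := by
  rw [OracleTM.init, regCfg]
  congr 1
  funext k
  cases k <;> rfl

theorem progMachine_exec {l l' : Λ} {s s' : RegState R} (h : (code l).exec O s = some (l', s')) :
    OracleTM.DetReach _ O s.cost (progCfg code l₀ lit p o l s) (progCfg code l₀ lit p o l' s') :=
  exec_detReach (prog := regProg code l₀ lit) (start := Sum.inl p) (o := o)
    (self := fun p => Sum.inr (l, p)) (go := fun l => Sum.inr (l, .run)) (fun _ => rfl) h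

theorem progMachine_halt {l : Λ} {v : Bool} (h : code l = .halt v) (s : RegState R) (T : ℕ) :
    OracleTM.Decides _ O (progCfg code l₀ lit p o l s) T (v = true) := by
  refine OracleTM.Decides.halt ?_ T
  change RegInstr.code (fun p => Sum.inr (l, p)) (fun l => Sum.inr (l, .run)) (code l) .run = _
  rw [h]
  rfl

theorem progMachine_guess {l next : Λ} {r : R} (h : code l = .guess r next) (s : RegState R)
    {T : ℕ} {A : List Bool → Prop}
    (hA : ∀ w : List Bool, w.length = s.cols.length → OracleTM.Decides _ O
      (progCfg code l₀ lit p o next { s with cols := setReg r w s.cols }) T (A w)) :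
    OracleTM.Decides _ O (progCfg code l₀ lit p o l s) (s.cost + T)
      (∃ w : List Bool, w.length = s.cols.length ∧ A w) := by
  have hp : ∀ ph, regProg code l₀ lit (Sum.inr (l, ph)) =
      RegInstr.code (fun p => Sum.inr (l, p)) (fun l => Sum.inr (l, .run)) (.guess r next) ph := by
    intro ph
    rw [← h]
    rfl
  have hg := guess_decides (O := O) (start := Sum.inl p) (o := o)
    (self := fun ph => Sum.inr (l, ph)) (go := fun l => Sum.inr (l, .run)) hp [] s.cols
    (tapeAt [] s.inp) (tapeAt [] s.qry) (tapeAt [] s.out) (T := T) (A := A) hA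
  refine (OracleTM.Decides.of_detReach (jump_detReach (hp .run) (.refl 0 _)) hg).mono ?_
  have hsz : s.size = s.cols.length + s.inp.length + s.qry.length := rfl
  rw [RegState.cost]
  simp
  nlinarith

/-- The state after reading an input, where the registers have been set to the words `u r` before
the columns are created. -/
def inputState (u : R → List Bool) (w : List Bool) : RegState R where
  cols := List.ofFn fun (j : Fin (unaryLength w)) r => (u r).getD j false
  inp := unaryRest w
  qry := []
  out := []

/-- This covers every word `w`, well-formed or not, because membership in `NPRel` bounds the running
time on all inputs. -/
theorem progMachine_columns (w : List Bool) :
    OracleTM.DetReach _ O (2 * unaryLength w + 2) ((progMachine code l₀ lit .columns o).init w)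
      (progCfg code l₀ lit .columns o l₀ (inputState (fun _ => []) w)) := by
  rw [progMachine_init]
  have := columns_detReach (prog := regProg code l₀ lit) (start := .inl .columns) (o := o) (O := O)
    (lit := lit) (self := .inl) (go := .inr (l₀, .run)) (fun _ => rfl) w [] (fun _ => [])
    (fun _ => Nat.zero_le _) (tapeAt [] []) (tapeAt [] [])
  rw [padCols_eq_ofFn] at this
  exact this.mono (by simp)

/-- The condition on `a` ensures that the word for the literal fits into the columns. -/
theorem progMachine_sign (s : Bool) (a : ℕ) (w : List Bool) (ha : a < unaryLength w) :
    OracleTM.DetReach _ O (2 * a + 2 * unaryLength w + 5)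
      ((progMachine code l₀ lit .sign o).init (s :: (List.replicate a true ++ false :: w)))
      (progCfg code l₀ lit .sign o l₀ (inputState
        (fun r => if r = lit s then List.replicate a false ++ [true] else []) w)) := by
  rw [progMachine_init]
  have h1 := columns_detReach (prog := regProg code l₀ lit) (start := .inl .sign) (o := o) (O := O)
    (lit := lit) (self := .inl) (go := .inr (l₀, .run)) (fun _ => rfl) w []
    (fun r => if r = lit s then List.replicate a false ++ [true] else [])
    (fun r => by by_cases h : r = lit s <;> simp [h]; omega) (tapeAt [] []) (tapeAt [] [])
  have h2 := unary_detReach (prog := regProg code l₀ lit) (start := .inl .sign) (o := o) (O := O)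
    (lit := lit) (self := .inl) (go := .inr (l₀, .run)) (fun _ => rfl) s a [] w
    (fun _ => tapeAt [] []) (tapeAt [] []) (tapeAt [] [])
  rw [padCols_eq_ofFn] at h1
  have hf : Function.update (fun _ : R => tapeAt [] []) (lit s)
      (tapeAt [] ([].reverse ++ (List.replicate a false ++ [true]))) =
      fun r => tapeAt (List.map (fun x : R → Bool => x r) [])
        (if r = lit s then List.replicate a false ++ [true] else []) := by
    funext r
    by_cases h : r = lit s
    · subst h
      simp
    · simp [h]
  rw [hf] at h2
  refine OracleTM.DetReach.mono (regMachine_detReach_act (q := .inl .sign) rfl (h2.trans h1)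
    ?_ ?_ ?_ ?_ ?_) (by simp; omega)
  case refine_2 =>
    intro r
    by_cases h1 : r = lit s <;> simp [onTapes, h1]
  all_goals simp [heads, onTapes]

end

/-! ### Straight-line programs for nondeterministic machines -/

inductive Stmt (R : Type)
  | map (g : (R → Bool) → R → Bool)
  | load (r : R)
  | guess (r : R)
  | image (x y : R)
  /-- Reject unless `f` holds in all columns. -/
  | all (f : (R → Bool) → Bool)
  /-- Reject unless `f` holds in some column. -/
  | any (f : (R → Bool) → Bool)
  | emit (f : (R → Bool) → Bool)
  | emitInput
  | push (b : Bool)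
  /-- Reject if the word on the query tape is in the oracle language. -/
  | refute

/-- The carry evaluates the quantifiers: it records a violation for `all` and a witness for `any`.
An `image` from a register to itself becomes a rejection, as `exec` is undefined for it. -/
def Stmt.toInstr [DecidableEq R] (next fail : Λ) : Stmt R → RegInstr R Λ
  | .map g => .map (fun c v => (c, g v)) fun _ => next
  | .load r => .load r next
  | .guess r => .guess r next
  | .image x y => if x = y then .halt false else .image x y next
  | .all f => .map (fun c v => (c || !f v, v)) fun c => if c then fail else next
  | .any f => .map (fun c v => (c || f v, v)) fun c => if c then next else fail
  | .emit f => .emit false (fun v => some (f v)) next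
  | .emitInput => .emitInput next
  | .push b => .push false b next
  | .refute => .ask fail next

/-- The program accepts for some choice of the guesses. -/
def Accepts [DecidableEq R] (O : Set (List Bool)) : List (Stmt R) → RegState R → Prop
  | [], _ => True
  | .map g :: L, s => Accepts O L { s with cols := s.cols.map g }
  | .load r :: L, s =>
      Accepts O L { s with cols := setReg r s.inp s.cols, inp := s.inp.drop s.cols.length }
  | .guess r :: L, s =>
      ∃ w : List Bool, w.length = s.cols.length ∧ Accepts O L { s with cols := setReg r w s.cols }
  | .image x y :: L, s => x ≠ y ∧ Accepts O L
      { s with cols := setReg y (imageOr (s.cols.map (· x)) s.inp (s.cols.map (· y))) s.cols }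
  | .all f :: L, s => (∀ v ∈ s.cols, f v) ∧ Accepts O L s
  | .any f :: L, s => (∃ v ∈ s.cols, f v) ∧ Accepts O L s
  | .emit f :: L, s => Accepts O L { s with qry := s.cols.map f ++ s.qry }
  | .emitInput :: L, s => Accepts O L { s with qry := s.inp ++ s.qry }
  | .push b :: L, s => Accepts O L { s with qry := b :: s.qry }
  | .refute :: L, s => s.qry ∉ O ∧ Accepts O L { s with qry := [] }

/-- The instruction with number `i` of a program, or acceptance at its end; the label `none` stands
for rejection. -/
def lineCode [DecidableEq R] (L : List (Stmt R)) :
    Option (Fin (L.length + 1)) → RegInstr R (Option (Fin (L.length + 1)))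
  | none => .halt false
  | some i =>
    match L[i.val]? with
    | none => .halt true
    | some st => st.toInstr (some (Fin.ofNat _ (i + 1))) none

/-- A time bound for straight-line programs with `k` statements. -/
noncomputable def timeBound : ℕ → ℕ[X]
  | 0 => 0
  -- The first summand is the cost of one statement. Emitting at most doubles the size of the state
  -- and `push` adds one, so the next state has size at most `2 * X + 1`.
  | k + 1 => 10 * (X + 1) ^ 2 + (timeBound k).comp (2 * X + 1)

theorem mealy_const (g : (R → Bool) → R → Bool) (c : Bool) (v : List (R → Bool)) :
    mealy (fun c v => (c, g v)) c v = (c, v.map g) := by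
  induction v with
  | nil => rfl
  | cons a v ih => simp [mealy, ih]

theorem mealy_or (f : (R → Bool) → Bool) (c : Bool) (v : List (R → Bool)) :
    mealy (fun c v => (c || f v, v)) c v = (c || v.any f, v) := by
  induction v generalizing c with
  | nil => simp [mealy]
  | cons a v ih => simp [mealy, ih, Bool.or_assoc]

theorem setReg_length [DecidableEq R] (r : R) (w : List Bool) (v : List (R → Bool)) :
    (setReg r w v).length = v.length := by
  induction v generalizing w with
  | nil => rfl
  | cons a v ih => simp [setReg, ih]

section

variable [Fintype R] [DecidableEq R] [Inhabited R] {lit : Bool → R} {p : Prelude} {o : RegTape R}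
  {O : Set (List Bool)}

/-- Induction on the statements still to be executed. The bound `N` on the size becomes `2 * N + 1`
after each statement, matching the recursion of `timeBound`. -/
theorem lineCode_decides (L : List (Stmt R)) (l₀ : Option (Fin (L.length + 1)))
    (suf : List (Stmt R)) (i : ℕ) (hi : L.drop i = suf) (hL : i ≤ L.length) (s : RegState R) (N : ℕ)
    (hs : s.size ≤ N) :
    OracleTM.Decides _ O (progCfg (lineCode L) l₀ lit p o (some (Fin.ofNat _ i)) s)
      ((timeBound suf.length).eval N) (Accepts O suf s) := by
  -- `Fin.ofNat` reduces modulo `L.length + 1`, which has no effect for `i ≤ L.length`.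
  have hv : (Fin.ofNat (L.length + 1) i).val = i := Nat.mod_eq_of_lt (by omega)
  have hrej : ∀ s T, OracleTM.Decides _ O (progCfg (lineCode L) l₀ lit p o none s) T False := by
    intro s T
    exact (progMachine_halt (l := none) rfl s T).congr (by simp)
  induction suf generalizing i s N with
  | nil =>
    have hc : lineCode L (some (Fin.ofNat _ i)) = .halt true := by
      have : L[i]? = none := by simpa using hi
      simp only [lineCode, hv, this]
    exact (progMachine_halt hc s _).congr (by simp [Accepts])
  | cons st suf ih =>
    have hst : L[i]? = some st := by
      have := congrArg List.head? hi
      simpa using this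
    have hi' : i < L.length := (List.getElem?_eq_some_iff.1 hst).1
    have hi1 : L.drop (i + 1) = suf := by
      rw [← List.tail_drop, hi, List.tail_cons]
    have hc : lineCode L (some (Fin.ofNat _ i)) =
        st.toInstr (some (Fin.ofNat _ (i + 1))) none := by
      simp only [lineCode, hv, hst]
    have IH := fun s hs => ih (i + 1) hi1 hi' s (2 * N + 1) hs
      (Nat.mod_eq_of_lt (by omega))
    have hT : (timeBound (st :: suf).length).eval N =
        10 * (N + 1) ^ 2 + (timeBound suf.length).eval (2 * N + 1) := by
      simp [timeBound]
    rw [hT]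
    have hcost : s.cost ≤ 10 * (N + 1) ^ 2 := by
      rw [RegState.cost]
      gcongr
    have hsz : s.size = s.cols.length + s.inp.length + s.qry.length := rfl
    have det : ∀ {l s' A}, (lineCode L (some (Fin.ofNat _ i))).exec O s = some (l, s') →
        OracleTM.Decides _ O (progCfg (lineCode L) l₀ lit p o l s')
          ((timeBound suf.length).eval (2 * N + 1)) A →
        OracleTM.Decides _ O (progCfg (lineCode L) l₀ lit p o (some (Fin.ofNat _ i)) s)
          (10 * (N + 1) ^ 2 + (timeBound suf.length).eval (2 * N + 1)) A :=
      fun he hd => (OracleTM.Decides.of_detReach (progMachine_exec he) hd).mono (by omega)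
    rw [hc] at det
    cases st with
    | map g =>
      refine det (by simp only [Stmt.toInstr, RegInstr.exec]; rfl) ?_
      simp only [mealy_const]
      exact IH _ (by simp [RegState.size]; omega)
    | load r =>
      refine det rfl (IH _ (by simp [RegState.size, setReg_length]; omega))
    | guess r =>
      exact (progMachine_guess hc s fun w _ => IH { s with cols := setReg r w s.cols }
        (by simp [RegState.size, setReg_length]; omega)).mono (by omega)
    | image x y =>
      by_cases hxy : x = y
      · exact (progMachine_halt (v := false) (hc.trans (by simp only [Stmt.toInstr, if_pos hxy])) s _).congr
          (by simp [Accepts, hxy])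
      · refine (det (by simp only [Stmt.toInstr, if_neg hxy, RegInstr.exec]; rfl)
          (IH _ (by simp [RegState.size, setReg_length]; omega))).congr ?_
        simp [Accepts, hxy]
    | all f =>
      by_cases h : ∀ v ∈ s.cols, f v
      · have hm : s.cols.any (fun v => !f v) = false := by simpa using h
        exact (det (by simp only [Stmt.toInstr, RegInstr.exec, mealy_or, hm]; rfl)
          (IH s (by omega))).congr (by simp only [Accepts]; tauto)
      · have hm : s.cols.any (fun v => !f v) = true := by simpa using h
        exact (det (by simp only [Stmt.toInstr, RegInstr.exec, mealy_or, hm]; rfl)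
          (hrej s _)).congr (by simp only [Accepts]; tauto)
    | any f =>
      by_cases h : ∃ v ∈ s.cols, f v
      · have hm : s.cols.any f = true := by simpa using h
        exact (det (by simp only [Stmt.toInstr, RegInstr.exec, mealy_or, hm]; rfl)
          (IH s (by omega))).congr (and_iff_right h).symm
      · have hm : s.cols.any f = false := by simpa using h
        exact (det (by simp only [Stmt.toInstr, RegInstr.exec, mealy_or, hm]; rfl)
          (hrej s _)).congr (iff_of_false id fun h' => h h'.1)
    | emit f =>
      refine (det rfl (IH _ ?_)).congr ?_
      · simp [RegState.size, RegState.pushOn]; omega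
      · simp [Accepts, RegState.pushOn]
    | emitInput =>
      refine (det rfl (IH _ ?_)).congr ?_
      · simp [RegState.size, RegState.pushOn]; omega
      · simp [Accepts, RegState.pushOn]
    | push b =>
      refine (det rfl (IH _ ?_)).congr ?_
      · simp [RegState.size, RegState.pushOn]; omega
      · simp [Accepts, RegState.pushOn]
    | refute =>
      classical
      by_cases h : s.qry ∈ O
      · refine (det (by simp only [Stmt.toInstr, RegInstr.exec, if_pos h]; rfl) (hrej _ _)).congr ?_
        simp [Accepts, h]
      · refine (det (by simp only [Stmt.toInstr, RegInstr.exec, if_neg h]; rfl) (IH _ ?_)).congr ?_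
        · simp [RegState.size]; omega
        · simp [Accepts, h]

theorem unary_add_rest_le (w : List Bool) :
    unaryLength w + (unaryRest w).length ≤ w.length := by
  have := congrArg List.length (List.takeWhile_append_dropWhile (p := id) (l := w))
  simp only [List.length_append] at this
  simp only [unaryLength, unaryRest, List.length_tail]
  omega

/-- Straight-line programs accept languages in nondeterministic polynomial time. -/
theorem accepts_mem_NPRel (O : Set (List Bool)) (L : List (Stmt R)) :
    {w | Accepts O L (inputState (fun _ => []) w)} ∈ NPRel O := by
  refine ⟨progMachine (lineCode L) (some (Fin.ofNat _ 0)) (fun _ => default) .columns .out,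
    2 * X + 2 + timeBound L.length, fun w => ?_⟩
  have h := lineCode_decides (O := O) (lit := fun _ => default) (p := .columns) (o := .out) L
    (some (Fin.ofNat _ 0)) L 0 rfl (Nat.zero_le _) (inputState (fun _ => []) w) w.length (by
      simpa [RegState.size, inputState] using unary_add_rest_le w)
  have := (OracleTM.Decides.of_detReach (progMachine_columns w) h).mono
    (T' := (2 * X + 2 + timeBound L.length).eval w.length) (by
      have := unary_add_rest_le w
      simp
      omega)
  exact this

end

end OracleComplexity

namespace OracleComplexity

variable {R : Type}

/-! ### Columns given by functions -/

/-- The state with columns `C`, matrix `m` and the word `q` on the query tape. -/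
def vecState {n : ℕ} (C : Fin n → R → Bool) (m q : List Bool) : RegState R where
  cols := List.ofFn C
  inp := m
  qry := q
  out := []

theorem inputState_unary (u : R → List Bool) (n : ℕ) (m : List Bool) :
    inputState u (List.replicate n true ++ false :: m) =
      vecState (fun (j : Fin n) r => (u r).getD j false) m [] := by
  have h1 : unaryLength (List.replicate n true ++ false :: m) = n := by
    simp [unaryLength]
  have h2 : unaryRest (List.replicate n true ++ false :: m) = m := by
    simp [unaryRest]
  rw [inputState, vecState, h2]
  congr 1
  -- The number of columns occurs in the type of their index, so it must become a variable before it
  -- can be identified with `n`.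
  generalize unaryLength (List.replicate n true ++ false :: m) = k at h1
  subst h1
  rfl

theorem setReg_ofFn [DecidableEq R] (r : R) (w : List Bool) {n : ℕ} (C : Fin n → R → Bool) :
    setReg r w (List.ofFn C) =
      List.ofFn fun j => Function.update (C j) r (w.getD j false) := by
  induction n generalizing w with
  | zero => simp [setReg]
  | succ n ih =>
    rw [List.ofFn_succ, setReg, ih, List.ofFn_succ]
    congr 1
    · cases w <;> rfl
    · congr 1
      funext j
      cases w <;> simp

theorem rowOr_ofFn (x : Bool) {n : ℕ} (row Y : Fin n → Bool) (m : List Bool) :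
    rowOr x (List.ofFn row ++ m) (List.ofFn Y) = List.ofFn fun j => Y j || (x && row j) := by
  induction n with
  | zero => simp [rowOr]
  | succ n ih => simp [List.ofFn_succ, rowOr, ih]

/-- Row `i` is consumed together with bit `i` of `X`, so the rows added to `Y` are those selected by
`X`: the relational image. -/
theorem imageOr_ofFn {k n : ℕ} (X : Fin k → Bool) (rows : Fin k → Fin n → Bool) (Y : Fin n → Bool) :
    imageOr (List.ofFn X) (List.ofFn fun i => List.ofFn (rows i)).flatten (List.ofFn Y) =
      List.ofFn fun j => Y j || decide (∃ i, X i = true ∧ rows i j = true) := by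
  induction k generalizing Y with
  | zero => simp [imageOr]
  | succ k ih =>
    simp only [List.ofFn_succ (f := X), List.ofFn_succ (f := fun i => List.ofFn (rows i)),
      List.flatten_cons, imageOr, rowOr_ofFn]
    rw [List.drop_left' (by simp), ih]
    congr 1
    funext j
    rw [Bool.or_assoc]
    congr 1
    rw [Bool.eq_iff_iff]
    simp [Fin.exists_fin_succ]

section

variable [DecidableEq R] {O : Set (List Bool)} {L : List (Stmt R)} {n : ℕ} {C : Fin n → R → Bool}
  {m q : List Bool}

theorem accepts_map {g : (R → Bool) → R → Bool} :
    Accepts O (.map g :: L) (vecState C m q) ↔ Accepts O L (vecState (fun j => g (C j)) m q) := by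
  simp [Accepts, vecState, List.map_ofFn, Function.comp_def]

theorem accepts_load {r : R} {e : Fin n → Bool} :
    Accepts O (.load r :: L) (vecState C (List.ofFn e ++ m) q) ↔
      Accepts O L (vecState (fun j => Function.update (C j) r (e j)) m q) := by
  simp only [Accepts, vecState, setReg_ofFn, List.length_ofFn]
  rw [List.drop_left' (by simp)]
  have : ∀ j : Fin n, (List.ofFn e ++ m).getD j false = e j := fun j => by
    simp [List.getD_eq_getElem?_getD, List.getElem?_append_left]
  simp only [this]

theorem accepts_guess {r : R} :
    Accepts O (.guess r :: L) (vecState C m q) ↔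
      ∃ e : Fin n → Bool, Accepts O L (vecState (fun j => Function.update (C j) r (e j)) m q) := by
  simp only [Accepts, vecState, setReg_ofFn, List.length_ofFn]
  constructor
  · rintro ⟨w, -, h⟩
    exact ⟨_, h⟩
  · rintro ⟨e, h⟩
    refine ⟨List.ofFn e, by simp, ?_⟩
    simpa using h

theorem accepts_image {x y : R} (hxy : x ≠ y) {rows : Fin n → Fin n → Bool} :
    Accepts O (.image x y :: L) (vecState C (List.ofFn fun i => List.ofFn (rows i)).flatten q) ↔
      Accepts O L (vecState (fun j => Function.update (C j) y
        (C j y || decide (∃ i, C i x = true ∧ rows i j = true)))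
        (List.ofFn fun i => List.ofFn (rows i)).flatten q) := by
  simp only [Accepts, vecState, List.map_ofFn, Function.comp_def, imageOr_ofFn, setReg_ofFn]
  simp [hxy]

theorem accepts_all {f : (R → Bool) → Bool} :
    Accepts O (.all f :: L) (vecState C m q) ↔ (∀ j, f (C j)) ∧ Accepts O L (vecState C m q) := by
  simp [Accepts, vecState]

theorem accepts_any {f : (R → Bool) → Bool} :
    Accepts O (.any f :: L) (vecState C m q) ↔ (∃ j, f (C j)) ∧ Accepts O L (vecState C m q) := by
  simp [Accepts, vecState, List.mem_ofFn]

theorem accepts_emit {f : (R → Bool) → Bool} :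
    Accepts O (.emit f :: L) (vecState C m q) ↔
      Accepts O L (vecState C m ((List.ofFn fun j => f (C j)) ++ q)) := by
  simp [Accepts, vecState, List.map_ofFn, Function.comp_def]

theorem accepts_emitInput :
    Accepts O (.emitInput :: L) (vecState C m q) ↔ Accepts O L (vecState C m (m ++ q)) := Iff.rfl

theorem accepts_push {b : Bool} :
    Accepts O (.push b :: L) (vecState C m q) ↔ Accepts O L (vecState C m (b :: q)) := Iff.rfl

theorem accepts_refute :
    Accepts O (.refute :: L) (vecState C m q) ↔ q ∉ O ∧ Accepts O L (vecState C m []) := Iff.rfl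

end

end OracleComplexity

namespace Argumentation

open OracleComplexity

/-! ### Programs that verify extensions -/

/-- Registers for sets of arguments: the positive and negative literals, the queried argument, an
extension, the arguments it attacks, those it does not attack, those it does not defend, a set
received in a query, and two results. -/
inductive Reg
  | pos | neg | arg | ext | att | unatt | undef | given | under | plain
  deriving DecidableEq, Inhabited

instance : Fintype Reg where
  elems := {.pos, .neg, .arg, .ext, .att, .unatt, .undef, .given, .under, .plain}
  complete r := by cases r <;> simp

/-- The rows of the adjacency matrix. -/
noncomputable def matrixWord {n : ℕ} (F : AF (Fin n)) : List Bool :=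
  (List.ofFn fun i : Fin n => setWord {j | F.attacks i j}).flatten

/-- A framework together with the sets of arguments `S`, as a word. -/
noncomputable def setsWord {n : ℕ} (F : AF (Fin n)) (S : List (Set (Fin n))) : List Bool :=
  List.replicate n true ++ false :: ((S.map setWord).flatten ++ matrixWord F)

/-- A set is conflict-free iff it is disjoint from the set it attacks. The register `att` is cleared
first because `image` only adds to its target. -/
def conflictFreeProg : List (Stmt Reg) :=
  [.map fun v => Function.update v .att false, .image .ext .att, .all fun v => !(v .ext && v .att)]

/-- An argument is undefended iff some attacker of it is not attacked by `ext`, so `undef` is the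
image of the complement of `att`. -/
def admissibleProg : List (Stmt Reg) :=
  conflictFreeProg ++
    [.map fun v => Function.update (Function.update v .unatt (!v .att)) .undef false,
      .image .unatt .undef, .all fun v => !(v .ext && v .undef)]

/-- Reject if the oracle accepts the framework with the set of columns for which `f` holds. -/
def refuteProg (f : (Reg → Bool) → Bool) : List (Stmt Reg) :=
  [.emitInput, .emit f, .push false, .emit fun _ => true, .refute]

/-- Check that the register `ext` holds a `σ`-extension. -/
def verifyProg : Semantics → List (Stmt Reg)
  | .adm => admissibleProg
  | .comp => admissibleProg ++ [.all fun v => v .ext == !v .undef]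
  | .stab => admissibleProg ++ [.all fun v => v .ext || v .att]
  | .pref => admissibleProg ++ refuteProg fun v => v .ext
  | .semi => admissibleProg ++ refuteProg fun v => v .ext || v .att
  | .stag => conflictFreeProg ++ refuteProg fun v => v .ext || v .att

/-- Guess a set that shows that a given set (or range) is not maximal. -/
def improveProg : Semantics → List (Stmt Reg)
  | .pref => [.load .given, .guess .ext] ++ admissibleProg ++
      [.all fun v => !v .given || v .ext, .any fun v => v .ext && !v .given]
  | .semi => [.load .given, .guess .ext] ++ admissibleProg ++
      [.all fun v => !v .given || (v .ext || v .att), .any fun v => (v .ext || v .att) && !v .given]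
  | .stag => [.load .given, .guess .ext] ++ conflictFreeProg ++
      [.all fun v => !v .given || (v .ext || v .att), .any fun v => (v .ext || v .att) && !v .given]
  | _ => []

/-- Check that there are an extension that contains the queried argument and an extension that does
not, both of which approve the literals. -/
def facetProg (σ : Semantics) : List (Stmt Reg) :=
  [.load .pos, .load .neg, .load .arg, .guess .ext] ++ verifyProg σ ++
    [.all fun v => (!v .pos || v .ext) && (!v .neg || !v .ext) && (!v .arg || v .ext),
      .guess .ext] ++ verifyProg σ ++
    [.all fun v => (!v .pos || v .ext) && (!v .neg || !v .ext) && (!v .arg || !v .ext)]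

variable {n : ℕ} {F : AF (Fin n)} {O : Set (List Bool)} {L : List (Stmt Reg)}
  {C : Fin n → Reg → Bool} {q : List Bool}

/-- The set of arguments in a register. -/
def regSet (C : Fin n → Reg → Bool) (r : Reg) : Set (Fin n) := {j | C j r = true}

theorem mem_regSet {r : Reg} {j : Fin n} : j ∈ regSet C r ↔ C j r = true := Iff.rfl

open Classical in
/-- Set a register to a set of arguments. -/
noncomputable def putReg (C : Fin n → Reg → Bool) (r : Reg) (S : Set (Fin n)) (j : Fin n) :
    Reg → Bool :=
  Function.update (C j) r (decide (j ∈ S))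

theorem putReg_self {r : Reg} {S : Set (Fin n)} {j : Fin n} :
    putReg C r S j r = true ↔ j ∈ S := by
  simp [putReg]

theorem putReg_of_ne {r r' : Reg} (h : r' ≠ r) {S : Set (Fin n)} {j : Fin n} :
    putReg C r S j r' = C j r' := by
  simp [putReg, h]

@[simp]
theorem regSet_putReg {r : Reg} {S : Set (Fin n)} : regSet (putReg C r S) r = S :=
  Set.ext fun _ => putReg_self

theorem regSet_putReg_of_ne {r r' : Reg} (h : r' ≠ r) {S : Set (Fin n)} :
    regSet (putReg C r S) r' = regSet C r' :=
  Set.ext fun j => by rw [mem_regSet, putReg_of_ne h, mem_regSet]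

/-- The arguments that are attacked by a set. -/
def attacked (F : AF (Fin n)) (E : Set (Fin n)) : Set (Fin n) := {j | ∃ i ∈ E, F.attacks i j}

theorem accepts_image_attacks {x y : Reg} (hxy : x ≠ y) :
    Accepts O (.image x y :: L) (vecState C (matrixWord F) q) ↔
      Accepts O L (vecState (putReg C y (regSet C y ∪ attacked F (regSet C x)))
        (matrixWord F) q) := by
  classical
  have h := accepts_image (O := O) (L := L) (C := C) (q := q) hxy
    (rows := fun i j => decide (j ∈ {j | F.attacks i j}))
  have h' : (fun j => Function.update (C j) y
      (C j y || decide (∃ i, C i x = true ∧ decide (j ∈ {j | F.attacks i j}) = true))) =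
      putReg C y (regSet C y ∪ attacked F (regSet C x)) := by
    funext j
    rw [putReg]
    congr 1
    rw [Bool.eq_iff_iff]
    simp [attacked, regSet]
  rw [h'] at h
  rw [matrixWord]
  simp only [setWord]
  convert h

/-- The columns after `conflictFreeProg`. -/
noncomputable def addAtt (F : AF (Fin n)) (C : Fin n → Reg → Bool) : Fin n → Reg → Bool :=
  putReg C .att (attacked F (regSet C .ext))

/-- The columns after `admissibleProg`. -/
noncomputable def addUndef (F : AF (Fin n)) (C : Fin n → Reg → Bool) : Fin n → Reg → Bool :=
  putReg (putReg (addAtt F C) .unatt (attacked F (regSet C .ext))ᶜ) .undef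
    (attacked F (attacked F (regSet C .ext))ᶜ)

theorem accepts_conflictFree :
    Accepts O (conflictFreeProg ++ L) (vecState C (matrixWord F) q) ↔
      F.ConflictFree (regSet C .ext) ∧ Accepts O L (vecState (addAtt F C) (matrixWord F) q) := by
  simp only [conflictFreeProg, List.cons_append, List.nil_append, accepts_map]
  have h1 : (fun j => Function.update (C j) Reg.att false) = putReg C .att ∅ := by
    funext j
    simp [putReg]
  have h2 : ∀ S, putReg (putReg C .att ∅) .att S = putReg C .att S := by
    intro S
    funext j
    simp [putReg]
  rw [h1, accepts_image_attacks (by decide), regSet_putReg, regSet_putReg_of_ne (by decide), h2,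
    Set.empty_union, accepts_all]
  refine and_congr_left fun _ => ?_
  have h3 : ∀ j, (!(putReg C .att (attacked F (regSet C .ext)) j .ext &&
      putReg C .att (attacked F (regSet C .ext)) j .att)) = true ↔
      ¬ (j ∈ regSet C .ext ∧ j ∈ attacked F (regSet C .ext)) := by
    intro j
    rw [← putReg_self (C := C) (r := .att) (j := j) (S := attacked F (regSet C .ext)), mem_regSet, putReg_of_ne (by decide)]
    cases C j .ext <;> simp
  simp only [h3]
  constructor
  · exact fun h a ha b hb hab => h b ⟨hb, a, ha, hab⟩
  · rintro h j ⟨hj, i, hi, hij⟩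
    exact h i hi j hj hij

theorem mem_defended_iff {E : Set (Fin n)} {j : Fin n} :
    j ∈ F.defended E ↔ j ∉ attacked F (attacked F E)ᶜ := by
  simp only [AF.defended, attacked]
  constructor
  · rintro h ⟨i, hi, hij⟩
    exact hi (h i hij)
  · intro h i hij
    by_contra hi
    exact h ⟨i, hi, hij⟩

theorem regSet_addAtt_ext : regSet (addAtt F C) .ext = regSet C .ext :=
  regSet_putReg_of_ne (by decide)

theorem regSet_addAtt_att : regSet (addAtt F C) .att = attacked F (regSet C .ext) :=
  regSet_putReg

theorem regSet_addUndef_ext : regSet (addUndef F C) .ext = regSet C .ext := by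
  rw [addUndef, regSet_putReg_of_ne (by decide), regSet_putReg_of_ne (by decide), regSet_addAtt_ext]

theorem regSet_addUndef_att : regSet (addUndef F C) .att = attacked F (regSet C .ext) := by
  rw [addUndef, regSet_putReg_of_ne (by decide), regSet_putReg_of_ne (by decide), regSet_addAtt_att]

theorem regSet_addUndef_undef :
    regSet (addUndef F C) .undef = attacked F (attacked F (regSet C .ext))ᶜ :=
  regSet_putReg

theorem accepts_admissible :
    Accepts O (admissibleProg ++ L) (vecState C (matrixWord F) q) ↔
      F.Admissible (regSet C .ext) ∧ Accepts O L (vecState (addUndef F C) (matrixWord F) q) := by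
  rw [admissibleProg, List.append_assoc, accepts_conflictFree, AF.Admissible, and_assoc]
  simp only [List.cons_append, List.nil_append, accepts_map]
  have h1 : (fun j => Function.update (Function.update (addAtt F C j) .unatt (!addAtt F C j .att))
      Reg.undef false) = putReg (putReg (addAtt F C) .unatt (attacked F (regSet C .ext))ᶜ) .undef ∅ := by
    funext j
    have : (!addAtt F C j .att) = true ↔ j ∈ (attacked F (regSet C .ext))ᶜ := by
      rw [Bool.not_eq_true', ← Bool.not_eq_true, addAtt, putReg_self, Set.mem_compl_iff]
    rw [putReg, putReg]
    congr 1
    · congr 1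
      rw [Bool.eq_iff_iff, this]
      simp
    · simp
  have h2 : ∀ S, putReg (putReg (putReg (addAtt F C) .unatt (attacked F (regSet C .ext))ᶜ) .undef ∅)
      .undef S = putReg (putReg (addAtt F C) .unatt (attacked F (regSet C .ext))ᶜ) .undef S := by
    intro S
    funext j
    simp [putReg]
  rw [h1, accepts_image_attacks (by decide), regSet_putReg, regSet_putReg_of_ne (by decide),
    regSet_putReg, h2, Set.empty_union, accepts_all]
  refine and_congr_right fun _ => ?_
  change _ ∧ Accepts O L (vecState (addUndef F C) (matrixWord F) q) ↔ _
  refine and_congr_left fun _ => forall_congr' fun j => ?_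
  change (!(addUndef F C j .ext && addUndef F C j .undef)) = true ↔ _
  rw [mem_defended_iff, ← regSet_addUndef_undef, ← regSet_addUndef_ext (F := F) (C := C), mem_regSet,
    mem_regSet]
  cases addUndef F C j .ext <;> cases addUndef F C j .undef <;> simp

/-- The query tape is a stack, so the parts of `setsWord F [S]` are pushed in reverse order: the
matrix, the set, the separator, and `1ⁿ` as one bit `true` per column. -/
theorem accepts_refuteProg {f : (Reg → Bool) → Bool} {S : Set (Fin n)} (hS : ∀ j, f (C j) = true ↔ j ∈ S) :
    Accepts O (refuteProg f ++ L) (vecState C (matrixWord F) []) ↔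
      setsWord F [S] ∉ O ∧ Accepts O L (vecState C (matrixWord F) []) := by
  simp only [refuteProg, List.cons_append, List.nil_append, accepts_emitInput, accepts_emit,
    accepts_push, accepts_refute]
  have h : (List.ofFn fun _ : Fin n => true) ++
      false :: ((List.ofFn fun j => f (C j)) ++ (matrixWord F ++ [])) = setsWord F [S] := by
    simp only [setsWord, setWord, List.ofFn_const, List.map_cons, List.map_nil, List.flatten_cons, List.flatten_nil,
      List.append_nil]
    congr 4
    funext j
    rw [Bool.eq_iff_iff, hS]
    simp
  rw [h]

/-- The oracle answers whether a set (or range) is not maximal. -/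
def ImproveOracle : Semantics → Set (List Bool) → Prop
  | .pref, O => ∀ (n : ℕ) (F : AF (Fin n)) (S : Set (Fin n)),
      setsWord F [S] ∈ O ↔ ∃ E, F.Admissible E ∧ S ⊂ E
  | .semi, O => ∀ (n : ℕ) (F : AF (Fin n)) (S : Set (Fin n)),
      setsWord F [S] ∈ O ↔ ∃ E, F.Admissible E ∧ S ⊂ F.range E
  | .stag, O => ∀ (n : ℕ) (F : AF (Fin n)) (S : Set (Fin n)),
      setsWord F [S] ∈ O ↔ ∃ E, F.ConflictFree E ∧ S ⊂ F.range E
  | _, _ => True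

theorem range_eq (E : Set (Fin n)) : F.range E = E ∪ attacked F E := rfl

theorem ext_or_att_iff {C' : Fin n → Reg → Bool} (h1 : regSet C' .ext = regSet C .ext)
    (h2 : regSet C' .att = attacked F (regSet C .ext)) (j : Fin n) :
    (C' j .ext || C' j .att) = true ↔ j ∈ F.range (regSet C .ext) := by
  rw [range_eq, ← h2, ← h1, Set.mem_union, mem_regSet, mem_regSet, Bool.or_eq_true]

/-- Only auxiliary registers change, so the literals, the queried argument and the extension
survive. The columns `C'` do not depend on `L`, so any further checks can be appended. For the last
three semantics maximality is a negative answer of the oracle. -/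
theorem accepts_verify (σ : Semantics) (hO : ImproveOracle σ O) :
    ∃ C' : Fin n → Reg → Bool, (∀ r, r = .pos ∨ r = .neg ∨ r = .arg ∨ r = .ext →
        regSet C' r = regSet C r) ∧ ∀ L,
      (Accepts O (verifyProg σ ++ L) (vecState C (matrixWord F) []) ↔
        regSet C .ext ∈ σ.extensions F ∧ Accepts O L (vecState C' (matrixWord F) [])) := by
  have hU : ∀ r, r = .pos ∨ r = .neg ∨ r = .arg ∨ r = .ext →
      regSet (addUndef F C) r = regSet C r := by
    rintro r hr
    rw [addUndef, addAtt, regSet_putReg_of_ne, regSet_putReg_of_ne, regSet_putReg_of_ne] <;>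
      rcases hr with rfl | rfl | rfl | rfl <;> decide
  have hA : ∀ r, r = .pos ∨ r = .neg ∨ r = .arg ∨ r = .ext →
      regSet (addAtt F C) r = regSet C r := by
    rintro r hr
    rw [addAtt, regSet_putReg_of_ne]
    rcases hr with rfl | rfl | rfl | rfl <;> decide
  cases σ with
  | adm => exact ⟨addUndef F C, hU, fun L => accepts_admissible⟩
  | comp =>
    refine ⟨addUndef F C, hU, fun L => ?_⟩
    rw [verifyProg, List.append_assoc, accepts_admissible, List.singleton_append, accepts_all,
      ← and_assoc]
    refine and_congr_left fun _ => and_congr_right fun _ => ?_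
    rw [eq_comm, Set.ext_iff]
    refine forall_congr' fun j => ?_
    rw [mem_defended_iff, ← regSet_addUndef_undef, ← regSet_addUndef_ext (F := F) (C := C),
      mem_regSet, mem_regSet]
    cases addUndef F C j .ext <;> cases addUndef F C j .undef <;> simp
  | stab =>
    refine ⟨addUndef F C, hU, fun L => ?_⟩
    rw [verifyProg, List.append_assoc, accepts_admissible, List.singleton_append, accepts_all,
      ← and_assoc]
    refine and_congr_left fun _ => and_congr_right fun _ => forall_congr' fun j => ?_
    rw [ext_or_att_iff regSet_addUndef_ext regSet_addUndef_att, range_eq, Set.mem_union,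
      or_iff_not_imp_left]
    rfl
  | pref =>
    refine ⟨addUndef F C, hU, fun L => ?_⟩
    rw [verifyProg, List.append_assoc, accepts_admissible,
      accepts_refuteProg (S := regSet C .ext) (fun j => by
        rw [← regSet_addUndef_ext (F := F) (C := C), mem_regSet]), ← and_assoc]
    refine and_congr_left fun _ => and_congr_right fun _ => not_congr ?_
    rw [hO n F]
    simp only [and_comm]
  | semi =>
    refine ⟨addUndef F C, hU, fun L => ?_⟩
    rw [verifyProg, List.append_assoc, accepts_admissible,
      accepts_refuteProg (ext_or_att_iff regSet_addUndef_ext regSet_addUndef_att), ← and_assoc]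
    exact and_congr_left fun _ => and_congr_right fun _ => not_congr (hO n F _)
  | stag =>
    refine ⟨addAtt F C, hA, fun L => ?_⟩
    rw [verifyProg, List.append_assoc, accepts_conflictFree,
      accepts_refuteProg (ext_or_att_iff regSet_addAtt_ext regSet_addAtt_att), ← and_assoc]
    exact and_congr_left fun _ => and_congr_right fun _ => not_congr (hO n F _)

theorem accepts_load_set {r : Reg} {S : Set (Fin n)} {m : List Bool} :
    Accepts O (.load r :: L) (vecState C (setWord S ++ m) q) ↔
      Accepts O L (vecState (putReg C r S) m q) :=
  accepts_load

theorem accepts_guess_set {r : Reg} {m : List Bool} :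
    Accepts O (.guess r :: L) (vecState C m q) ↔
      ∃ E : Set (Fin n), Accepts O L (vecState (putReg C r E) m q) := by
  rw [accepts_guess]
  constructor
  · rintro ⟨e, h⟩
    refine ⟨{j | e j = true}, ?_⟩
    convert h using 2
    funext j
    simp [putReg]
  · rintro ⟨E, h⟩
    exact ⟨_, h⟩

theorem inputState_setsWord (S : List (Set (Fin n))) :
    inputState (fun _ : Reg => []) (setsWord F S) =
      vecState (fun (_ : Fin n) _ => false) ((S.map setWord).flatten ++ matrixWord F) [] := by
  rw [setsWord, inputState_unary]
  rfl

/-! ### The oracle languages -/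

/-- The language of the frameworks with a set (or range) that is not maximal. -/
def improveLanguage (σ : Semantics) : Set (List Bool) :=
  {w | Accepts ∅ (improveProg σ) (inputState (fun _ => []) w)}

theorem improveLanguage_mem_NP (σ : Semantics) : improveLanguage σ ∈ NP :=
  accepts_mem_NPRel ∅ _

/-- Inclusion is a condition on all columns, and strictness needs one further witnessing column. -/
theorem ssubset_check {C' : Fin n → Reg → Bool} {S T : Set (Fin n)} {f g : (Reg → Bool) → Bool}
    (hf : ∀ j, f (C' j) = true ↔ j ∈ S) (hg : ∀ j, g (C' j) = true ↔ j ∈ T) {m : List Bool} :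
    Accepts O [.all fun v => !f v || g v, .any fun v => g v && !f v] (vecState C' m q) ↔ S ⊂ T := by
  rw [accepts_all, accepts_any, Set.ssubset_iff_exists]
  refine and_congr (forall_congr' fun j => ?_) ?_
  · rw [← hf, ← hg]
    cases f (C' j) <;> simp
  · simp only [Accepts, and_true]
    refine exists_congr fun j => ?_
    rw [← hf, ← hg]
    simp

/-- The checks do not write to `given`, so the received set can still be compared with the guessed
set or its range afterwards. -/
theorem improveOracle_improveLanguage (σ : Semantics) : ImproveOracle σ (improveLanguage σ) := by
  have hext : ∀ {n : ℕ} (S E : Set (Fin n)),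
      regSet (putReg (putReg (fun _ _ => false) .given S) .ext E) .ext = E := by simp
  have hU : ∀ {n : ℕ} (F : AF (Fin n)) (S E : Set (Fin n)) (j : Fin n),
      addUndef F (putReg (putReg (fun _ _ => false) .given S) .ext E) j .given = true ↔ j ∈ S := by
    intro n F S E j
    rw [addUndef, addAtt, putReg_of_ne (by decide), putReg_of_ne (by decide),
      putReg_of_ne (by decide), putReg_of_ne (by decide), putReg_self]
  have hA : ∀ {n : ℕ} (F : AF (Fin n)) (S E : Set (Fin n)) (j : Fin n),
      addAtt F (putReg (putReg (fun _ _ => false) .given S) .ext E) j .given = true ↔ j ∈ S := by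
    intro n F S E j
    rw [addAtt, putReg_of_ne (by decide), putReg_of_ne (by decide), putReg_self]
  cases σ with
  | adm => trivial
  | comp => trivial
  | stab => trivial
  | pref =>
    intro n F S
    rw [improveLanguage, Set.mem_ofPred_eq, inputState_setsWord]
    simp only [improveProg, List.cons_append, List.nil_append, List.map_cons, List.map_nil,
      List.flatten_cons, List.flatten_nil, List.append_nil, accepts_load_set, accepts_guess_set,
      accepts_admissible, hext]
    refine exists_congr fun E => and_congr_right fun _ => ?_
    exact ssubset_check (hU F S E) fun j => by
      rw [← mem_regSet, regSet_addUndef_ext, hext]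
  | semi =>
    intro n F S
    rw [improveLanguage, Set.mem_ofPred_eq, inputState_setsWord]
    simp only [improveProg, List.cons_append, List.nil_append, List.map_cons, List.map_nil,
      List.flatten_cons, List.flatten_nil, List.append_nil, accepts_load_set, accepts_guess_set,
      accepts_admissible, hext]
    refine exists_congr fun E => and_congr_right fun _ => ?_
    refine ssubset_check (hU F S E) fun j => ?_
    rw [ext_or_att_iff regSet_addUndef_ext regSet_addUndef_att, hext]
  | stag =>
    intro n F S
    rw [improveLanguage, Set.mem_ofPred_eq, inputState_setsWord]
    simp only [improveProg, List.cons_append, List.nil_append, List.map_cons, List.map_nil,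
      List.flatten_cons, List.flatten_nil, List.append_nil, accepts_load_set, accepts_guess_set,
      accepts_conflictFree, hext]
    refine exists_congr fun E => and_congr_right fun _ => ?_
    refine ssubset_check (hA F S E) fun j => ?_
    rw [ext_or_att_iff regSet_addAtt_ext regSet_addAtt_att, hext]

/-- The language of the frameworks with two sets of literals and a facet under these literals. -/
def facetLanguage (σ : Semantics) (O : Set (List Bool)) : Set (List Bool) :=
  {w | Accepts O (facetProg σ) (inputState (fun _ => []) w)}

theorem facetLanguage_mem_NPRel (σ : Semantics) (O : Set (List Bool)) :
    facetLanguage σ O ∈ NPRel O :=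
  accepts_mem_NPRel O _

/-- The oracle answers whether an argument is a facet under two sets of literals. -/
def FacetOracle (σ : Semantics) (O : Set (List Bool)) : Prop :=
  ∀ (n : ℕ) (F : AF (Fin n)) (P N : Set (Fin n)) (i : Fin n), setsWord F [P, N, {i}] ∈ O ↔
    (∃ E ∈ σ.extensions F, (P ⊆ E ∧ ∀ a ∈ N, a ∉ E) ∧ i ∈ E) ∧
    (∃ E ∈ σ.extensions F, (P ⊆ E ∧ ∀ a ∈ N, a ∉ E) ∧ i ∉ E)

theorem facetOracle_facetLanguage (σ : Semantics) (hO : ImproveOracle σ O) :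
    FacetOracle σ (facetLanguage σ O) := by
  intro n F P N i
  rw [facetLanguage, Set.mem_ofPred_eq, inputState_setsWord]
  simp only [facetProg, List.cons_append, List.nil_append, List.append_assoc, List.map_cons,
    List.map_nil, List.flatten_cons, List.flatten_nil, List.append_nil, accepts_load_set]
  -- One half of the program, followed by `L`: for `f = id` it looks for an extension with `i`, for
  -- `f = not` for one without. The condition `B` for the rest relies only on the registers `pos`,
  -- `neg` and `arg`, so the two choices are independent.
  have key : ∀ (C : Fin n → Reg → Bool), regSet C .pos = P → regSet C .neg = N →
      regSet C .arg = {i} → ∀ (f : Bool → Bool) (L : List (Stmt Reg)) (B : Prop),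
      (∀ C' : Fin n → Reg → Bool, regSet C' .pos = P → regSet C' .neg = N → regSet C' .arg = {i} →
        (Accepts O L (vecState C' (matrixWord F) []) ↔ B)) →
      (Accepts O (.guess .ext :: (verifyProg σ ++ (.all fun v => (!v .pos || v .ext) &&
        (!v .neg || !v .ext) && (!v .arg || f (v .ext))) :: L)) (vecState C (matrixWord F) []) ↔
        (∃ E ∈ σ.extensions F, (P ⊆ E ∧ ∀ a ∈ N, a ∉ E) ∧ ∃ b, (b = true ↔ i ∈ E) ∧ f b = true) ∧ B) := by
    intro C hP hN hi f L B hB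
    rw [accepts_guess_set, ← exists_and_right]
    refine exists_congr fun E => ?_
    obtain ⟨C', hC, hL⟩ := accepts_verify (F := F) (C := putReg C .ext E) σ hO
    have hE : regSet C' .ext = E := by rw [hC _ (by simp), regSet_putReg]
    have hP' : regSet C' .pos = P := by
      rw [hC _ (by simp), regSet_putReg_of_ne (by decide), hP]
    have hN' : regSet C' .neg = N := by
      rw [hC _ (by simp), regSet_putReg_of_ne (by decide), hN]
    have hi' : regSet C' .arg = {i} := by
      rw [hC _ (by simp), regSet_putReg_of_ne (by decide), hi]
    rw [hL, accepts_all, hB C' hP' hN' hi', regSet_putReg, ← and_assoc, and_assoc, and_assoc]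
    refine and_congr_right fun _ => and_congr_left fun _ => ?_
    have hi2 : ∀ j, C' j .arg = true ↔ j = i := fun j => by
      rw [← mem_regSet, hi', Set.mem_singleton_iff]
    have hall : (∀ j, ((!C' j .pos || C' j .ext) && (!C' j .neg || !C' j .ext) &&
        (!C' j .arg || f (C' j .ext))) = true) ↔ ((∀ j, C' j .pos = true → C' j .ext = true) ∧
        (∀ j, C' j .neg = true → ¬ C' j .ext = true)) ∧
        (∀ j, C' j .arg = true → f (C' j .ext) = true) := by
      rw [← forall_and, ← forall_and]
      refine forall_congr' fun j => ?_
      cases C' j .pos <;> cases C' j .neg <;> cases C' j .arg <;> simp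
    rw [hall, ← hE, ← hP', ← hN']
    refine and_congr_right fun _ => ?_
    -- The register `arg` holds only `i`, so the last check concerns a single column.
    simp only [hi2, forall_eq, mem_regSet]
    constructor
    · exact fun h => ⟨_, Iff.rfl, h⟩
    · rintro ⟨b, hb, h⟩
      rwa [← Bool.eq_iff_iff.2 hb]
  have hpos := key (putReg (putReg (putReg (fun _ _ => false) .pos P) .neg N) .arg {i})
    (by rw [regSet_putReg_of_ne (by decide), regSet_putReg_of_ne (by decide), regSet_putReg])
    (by rw [regSet_putReg_of_ne (by decide), regSet_putReg]) regSet_putReg id _ _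
    fun C' hP hN hi => key C' hP hN hi not [] True fun _ _ _ _ => Iff.rfl
  simp only [id] at hpos
  rw [hpos]
  refine and_congr ?_ ?_
  · refine exists_congr fun E => and_congr_right fun _ => and_congr_right fun _ => ?_
    simp
  · rw [and_true]
    refine exists_congr fun E => and_congr_right fun _ => and_congr_right fun _ => ?_
    simp

end Argumentation

namespace Argumentation

open OracleComplexity

/-! ### The deterministic machine -/

/-- For one argument after the other, the queries whether it is a facet under the literals in the
registers `pos` and `neg`, and whether it is a facet. The answers are collected in the registers
`under` and `plain`. Finally, the significance is put out. -/
def facetCode : Fin 22 → RegInstr Reg (Fin 22) := ![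
  .map (fun c v => (true, Function.update v .arg (!c))) fun _ => 1,
  .emitInput 2,
  .emit false (fun v => some (v .arg)) 3,
  .emit false (fun v => some (v .neg)) 4,
  .emit false (fun v => some (v .pos)) 5,
  .push false false 6,
  .emit false (fun _ => some true) 7,
  .ask 8 9,
  .map (fun c v => (c, Function.update v .under (v .under || v .arg))) fun _ => 9,
  .emitInput 10,
  .emit false (fun v => some (v .arg)) 11,
  .emit false (fun _ => some false) 12,
  .emit false (fun _ => some false) 13,
  .push false false 14,
  .emit false (fun _ => some true) 15,
  .ask 16 17,
  .map (fun c v => (c, Function.update v .plain (v .plain || v .arg))) fun _ => 17,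
  .map (fun c v => (v .arg, Function.update v .arg c)) fun c => if c then 18 else 1,
  -- The output is a stack, so the denominator is written first and the numerator ends up in front
  -- of it.
  .emit true (fun v => if v .plain then some true else none) 19,
  .push true false 20,
  .emit true (fun v => if v .plain && !v .under then some true else none) 21,
  .halt true]

def litReg (s : Bool) : Reg := if s then .pos else .neg

abbrev facetMachine (p : Prelude) (o : RegTape Reg) : OracleTM := progMachine facetCode 0 litReg p o

/-- Only the instruction `guess` compiles to a guessing state, and `facetCode` has none. -/
theorem facetMachine_deterministic (p : Prelude) (o : RegTape Reg) :
    (facetMachine p o).Deterministic := by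
  intro q q₀ q₁ h
  change regProg facetCode 0 litReg q = .guess q₀ q₁ at h
  match q with
  | .inl s => cases s <;> simp [regProg, preludeCode, actInstr, returnInstr] at h
  | .inr (l, ph) =>
    have hl : ∀ l r next, facetCode l ≠ .guess r next := by
      intro l r next
      fin_cases l <;> simp [facetCode]
    rw [regProg] at h
    cases hc : facetCode l with
    | guess r next => exact hl l r next hc
    | _ => rw [hc] at h; cases ph <;> simp [RegInstr.code, jump, actInstr, returnInstr] at h

variable {n : ℕ} {F : AF (Fin n)} {O : Set (List Bool)} {C : Fin n → Reg → Bool}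
  {m q : List Bool} {p : Prelude} {o : RegTape Reg}

theorem putReg_regSet (C : Fin n → Reg → Bool) (r : Reg) : putReg C r (regSet C r) = C := by
  funext j
  simp [putReg, mem_regSet]

theorem setWord_eq_ofFn {S : Set (Fin n)} {f : Fin n → Bool} (h : ∀ j, f j = true ↔ j ∈ S) :
    List.ofFn f = setWord S := by
  rw [setWord]
  congr 1
  funext j
  rw [Bool.eq_iff_iff, h]
  simp

theorem exec_emit_set {Λ : Type} {f : (Reg → Bool) → Bool} {S : Set (Fin n)}
    (hS : ∀ j, f (C j) = true ↔ j ∈ S) (next : Λ) :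
    (RegInstr.emit false (fun v => some (f v)) next).exec O (vecState C m q) =
      some (next, vecState C m (setWord S ++ q)) := by
  rw [← setWord_eq_ofFn hS]
  simp [RegInstr.exec, RegState.pushOn, vecState, List.map_ofFn, Function.comp_def]

/-! ### The queries about one argument -/

/-- A bound for the number of steps that one instruction takes. -/
def roundCost (n : ℕ) (m : List Bool) : ℕ := 10 * (5 * n + 2 * m.length + 2) ^ 2

/-- A complete query with three sets has length `4 * n + m.length + 1`; the columns and the input
contribute another `n + m.length` to the size. -/
theorem vecState_cost_le (hq : q.length ≤ 4 * n + m.length + 1) :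
    (vecState C m q).cost ≤ roundCost n m := by
  rw [RegState.cost, roundCost]
  refine Nat.mul_le_mul_left _ (Nat.pow_le_pow_left ?_ 2)
  simp [RegState.size, vecState]
  omega

theorem setWord_length (S : Set (Fin n)) : (setWord S).length = n := by
  simp [setWord]

-- The labels are arbitrary because the same seven instructions occur twice: with the literals in
-- `pos` and `neg`, and with the constant `false` for empty sets of literals.
open Classical in
theorem query_detReach {l₁ l₂ l₃ l₄ l₅ l₆ l₇ yes no : Fin 22} {f g : (Reg → Bool) → Bool}
    (h₁ : facetCode l₁ = .emitInput l₂)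
    (h₂ : facetCode l₂ = .emit false (fun v => some (v .arg)) l₃)
    (h₃ : facetCode l₃ = .emit false (fun v => some (g v)) l₄)
    (h₄ : facetCode l₄ = .emit false (fun v => some (f v)) l₅)
    (h₅ : facetCode l₅ = .push false false l₆)
    (h₆ : facetCode l₆ = .emit false (fun _ => some true) l₇)
    (h₇ : facetCode l₇ = .ask yes no) {P N : Set (Fin n)}
    (hf : ∀ j, f (C j) = true ↔ j ∈ P) (hg : ∀ j, g (C j) = true ↔ j ∈ N) :
    OracleTM.DetReach (facetMachine p o) O (7 * roundCost n (matrixWord F))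
      (progCfg facetCode 0 litReg p o l₁ (vecState C (matrixWord F) []))
      (progCfg facetCode 0 litReg p o (if setsWord F [P, N, regSet C .arg] ∈ O then yes else no)
        (vecState C (matrixWord F) [])) := by
  have step : ∀ {l l' : Fin 22} {q : List Bool} {s' : RegState Reg},
      (facetCode l).exec O (vecState C (matrixWord F) q) = some (l', s') →
      q.length ≤ 4 * n + (matrixWord F).length + 1 →
      OracleTM.DetReach (facetMachine p o) O (roundCost n (matrixWord F))
        (progCfg facetCode 0 litReg p o l (vecState C (matrixWord F) q))
        (progCfg facetCode 0 litReg p o l' s') :=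
    fun he hq => (progMachine_exec he).mono (vecState_cost_le hq)
  have e₁ : (facetCode l₁).exec O (vecState C (matrixWord F) []) =
      some (l₂, vecState C (matrixWord F) (matrixWord F)) := by
    rw [h₁]
    simp [RegInstr.exec, RegState.pushOn, vecState]
  have e₂ := exec_emit_set (O := O) (m := matrixWord F) (q := matrixWord F)
    (f := fun v => v .arg) (S := regSet C .arg) (fun _ => Iff.rfl) l₃
  have e₃ := exec_emit_set (O := O) (m := matrixWord F)
    (q := setWord (regSet C .arg) ++ matrixWord F) hg l₄
  have e₄ := exec_emit_set (O := O) (m := matrixWord F)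
    (q := setWord N ++ (setWord (regSet C .arg) ++ matrixWord F)) hf l₅
  rw [← h₂] at e₂
  rw [← h₃] at e₃
  rw [← h₄] at e₄
  have e₅ : (facetCode l₅).exec O (vecState C (matrixWord F)
      (setWord P ++ (setWord N ++ (setWord (regSet C .arg) ++ matrixWord F)))) =
      some (l₆, vecState C (matrixWord F)
        (false :: (setWord P ++ (setWord N ++ (setWord (regSet C .arg) ++ matrixWord F))))) := by
    rw [h₅]
    simp [RegInstr.exec, RegState.pushOn, vecState]
  have e₆ : (facetCode l₆).exec O (vecState C (matrixWord F)
      (false :: (setWord P ++ (setWord N ++ (setWord (regSet C .arg) ++ matrixWord F))))) =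
      some (l₇, vecState C (matrixWord F) (setsWord F [P, N, regSet C .arg])) := by
    rw [h₆, exec_emit_set (f := fun _ => true) (S := Set.univ) (fun _ => by simp) l₇]
    have : setWord (Set.univ : Set (Fin n)) = List.replicate n true := by
      rw [← setWord_eq_ofFn (f := fun _ => true) (by simp), List.ofFn_const]
    simp [this, setsWord]
  have e₇ : (facetCode l₇).exec O (vecState C (matrixWord F) (setsWord F [P, N, regSet C .arg])) =
      some (if setsWord F [P, N, regSet C .arg] ∈ O then yes else no,
        vecState C (matrixWord F) []) := by
    rw [h₇]
    rfl
  have := (step e₁ (by simp)).trans ((step e₂ (by omega)).trans ((step e₃ (by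
    simp [setWord_length]; omega)).trans ((step e₄ (by
    simp [setWord_length]; omega)).trans ((step e₅ (by
    simp [setWord_length]; omega)).trans ((step e₆ (by
    simp [setWord_length]; omega)).trans (step e₇ (by simp [setsWord, setWord_length]; omega)))))))
  exact this.mono (by omega)

/-- The answer to a query about the argument in the register `arg` is recorded. -/
theorem record_detReach {l l' : Fin 22} {r : Reg}
    (h : facetCode l = .map (fun c v => (c, Function.update v r (v r || v .arg))) fun _ => l') :
    OracleTM.DetReach (facetMachine p o) O (roundCost n m)
      (progCfg facetCode 0 litReg p o l (vecState C m []))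
      (progCfg facetCode 0 litReg p o l'
        (vecState (putReg C r (regSet C r ∪ regSet C .arg)) m [])) := by
  refine (progMachine_exec (l' := l') ?_).mono (vecState_cost_le (by simp))
  rw [h]
  simp only [RegInstr.exec, mealy_const, vecState, List.map_ofFn]
  congr 4
  funext j
  rw [putReg]
  simp only [Function.comp_apply]
  congr 1
  rw [Bool.eq_iff_iff]
  simp [mem_regSet]

/-- The carry holds the bit of the previous column, so the word in `arg` moves right by one place,
and the bit shifted out of the last column is the final carry. -/
theorem shift_mealy (c : Bool) (C : Fin n → Reg → Bool) :
    mealy (fun c v => (v .arg, Function.update v .arg c)) c (List.ofFn C) =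
      (if h : n = 0 then c else C ⟨n - 1, by omega⟩ .arg,
        List.ofFn fun j => Function.update (C j) .arg
          (if j.val = 0 then c else C ⟨j - 1, by omega⟩ .arg)) := by
  induction n generalizing c with
  | zero => simp [mealy]
  | succ n ih =>
    rw [List.ofFn_succ, mealy, ih]
    refine Prod.ext ?_ ?_
    · by_cases h : n = 0
      · subst h
        rfl
      · simp only [h, dite_false, Nat.add_one_ne_zero]
        congr 2
        ext
        simp
        omega
    · rw [List.ofFn_succ]
      refine congrArg₂ _ rfl ?_
      dsimp only
      congr 1
      funext j
      by_cases h : j.val = 0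
      · simp [h]
      · simp only [h, if_false, Fin.val_succ, Nat.add_one_ne_zero]
        congr 3
        ext
        simp
        omega

/-- The pointer to the current argument is moved to the next argument, if there is one. -/
theorem shift_detReach {i : ℕ} (hi : i < n) (hC : regSet C .arg = {j | j.val = i}) :
    OracleTM.DetReach (facetMachine p o) O (roundCost n m)
      (progCfg facetCode 0 litReg p o 17 (vecState C m []))
      (progCfg facetCode 0 litReg p o (if i + 1 = n then 18 else 1)
        (vecState (putReg C .arg {j | j.val = i + 1}) m [])) := by
  refine (progMachine_exec ?_).mono (vecState_cost_le (by simp))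
  have h : facetCode 17 = .map (fun c v => (v .arg, Function.update v .arg c))
      fun c => if c then 18 else 1 := rfl
  have hC' : ∀ j, C j .arg = decide (j.val = i) := fun j => by
    have : j ∈ regSet C .arg ↔ j.val = i := by rw [hC]; rfl
    rw [Bool.eq_iff_iff, ← mem_regSet, this, decide_eq_true_eq]
  rw [h]
  simp only [RegInstr.exec, vecState, shift_mealy, hC']
  congr 3
  -- The bit shifted out comes from column `n - 1`, so it is set exactly when `i + 1 = n`.
  · rw [dif_neg (by omega)]
    rw [decide_eq_true_eq]
    exact propext (by omega)
  · congr 2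
    funext j
    rw [putReg]
    congr 1
    rw [Bool.eq_iff_iff]
    by_cases h0 : j.val = 0
    · simp [h0]
    · simp [h0]
      omega

/-- The pointer to the current argument is set to the first argument. -/
theorem start_detReach (C : Fin n → Reg → Bool) :
    OracleTM.DetReach (facetMachine p o) O (roundCost n m)
      (progCfg facetCode 0 litReg p o 0 (vecState C m []))
      (progCfg facetCode 0 litReg p o 1 (vecState (putReg C .arg {j | j.val = 0}) m [])) := by
  refine (progMachine_exec ?_).mono (vecState_cost_le (by simp))
  have h : facetCode 0 = .map (fun c v => (true, Function.update v .arg (!c))) fun _ => 1 := rfl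
  have hm : ∀ (n : ℕ) (C : Fin n → Reg → Bool) (c : Bool),
      (mealy (fun c v => (true, Function.update v Reg.arg (!c))) c (List.ofFn C)).2 =
      List.ofFn fun j => Function.update (C j) .arg (!c && decide (j.val = 0)) := by
    intro n
    induction n with
    | zero => simp [mealy]
    | succ n ih =>
      intro C c
      rw [List.ofFn_succ, mealy, ih, List.ofFn_succ]
      simp
  rw [h]
  simp only [RegInstr.exec, vecState, hm]
  congr 4
  funext j
  rw [putReg]
  congr 1
  rw [Bool.eq_iff_iff]
  simp

/-! ### The loop over the arguments -/

/-- The arguments before the argument with number `i` for which the oracle gives a positive answer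
under the literals `P` and `N`. -/
def answers (O : Set (List Bool)) (F : AF (Fin n)) (P N : Set (Fin n)) (i : ℕ) : Set (Fin n) :=
  {j | j.val < i ∧ setsWord F [P, N, {j}] ∈ O}

/-- The columns when the arguments before the argument with number `i` have been treated. -/
structure RoundInv (O : Set (List Bool)) (F : AF (Fin n)) (P N : Set (Fin n)) (i : ℕ)
    (C : Fin n → Reg → Bool) : Prop where
  arg : regSet C .arg = {j | j.val = i}
  pos : regSet C .pos = P
  neg : regSet C .neg = N
  under : regSet C .under = answers O F P N i
  plain : regSet C .plain = answers O F ∅ ∅ i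

theorem answers_succ {P N : Set (Fin n)} {i : ℕ} (hi : i < n) :
    answers O F P N (i + 1) =
      answers O F P N i ∪ {j | j.val = i ∧ setsWord F [P, N, {⟨i, hi⟩}] ∈ O} := by
  ext j
  simp only [answers, Set.mem_union, Set.mem_ofPred_eq]
  constructor
  · rintro ⟨h1, h2⟩
    by_cases h : j.val = i
    · subst h
      exact Or.inr ⟨rfl, h2⟩
    · exact Or.inl ⟨by omega, h2⟩
  · rintro (⟨h1, h2⟩ | ⟨h1, h2⟩)
    · exact ⟨by omega, h2⟩
    · subst h1
      exact ⟨by omega, h2⟩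

theorem ask_record_detReach {l₁ l₂ l₃ l₄ l₅ l₆ l₇ yes no : Fin 22} {f g : (Reg → Bool) → Bool}
    {r : Reg} (h₁ : facetCode l₁ = .emitInput l₂)
    (h₂ : facetCode l₂ = .emit false (fun v => some (v .arg)) l₃)
    (h₃ : facetCode l₃ = .emit false (fun v => some (g v)) l₄)
    (h₄ : facetCode l₄ = .emit false (fun v => some (f v)) l₅)
    (h₅ : facetCode l₅ = .push false false l₆)
    (h₆ : facetCode l₆ = .emit false (fun _ => some true) l₇)
    (h₇ : facetCode l₇ = .ask yes no)
    (h₈ : facetCode yes = .map (fun c v => (c, Function.update v r (v r || v .arg))) fun _ => no)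
    {P N : Set (Fin n)} {i : ℕ} (hi : i < n)
    (hf : ∀ j, f (C j) = true ↔ j ∈ P) (hg : ∀ j, g (C j) = true ↔ j ∈ N)
    (hC : regSet C .arg = {j | j.val = i}) (hr : regSet C r = answers O F P N i) :
    OracleTM.DetReach (facetMachine p o) O (8 * roundCost n (matrixWord F))
      (progCfg facetCode 0 litReg p o l₁ (vecState C (matrixWord F) []))
      (progCfg facetCode 0 litReg p o no
        (vecState (putReg C r (answers O F P N (i + 1))) (matrixWord F) [])) := by
  classical
  have hs : regSet C .arg = {⟨i, hi⟩} := by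
    rw [hC]
    ext j
    simp [Fin.ext_iff]
  have hq := query_detReach (p := p) (o := o) (F := F) (O := O) h₁ h₂ h₃ h₄ h₅ h₆ h₇ hf hg
  rw [answers_succ hi]
  by_cases h : setsWord F [P, N, {⟨i, hi⟩}] ∈ O
  · rw [hs, if_pos h] at hq
    have hrec := record_detReach (p := p) (o := o) (O := O) (C := C) (m := matrixWord F) h₈
    rw [hr, hC] at hrec
    have hi' : {j : Fin n | j.val = i ∧ setsWord F [P, N, {⟨i, hi⟩}] ∈ O} = {j | j.val = i} := by
      simp [h]
    rw [hi']
    exact (hq.trans hrec).mono (by omega)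
  -- After a negative answer the recording instruction is skipped, and the set of answers does not
  -- grow.
  · rw [hs, if_neg h] at hq
    have : answers O F P N i ∪ {j | j.val = i ∧ setsWord F [P, N, {⟨i, hi⟩}] ∈ O} = regSet C r := by
      simp [h, hr]
    rw [this, putReg_regSet]
    exact hq.mono (by omega)

/-- Two recorded queries at cost 8 each and one shift of the pointer make 17. -/
theorem round_detReach {P N : Set (Fin n)} {i : ℕ} (hi : i < n) (hC : RoundInv O F P N i C) :
    ∃ C' : Fin n → Reg → Bool, RoundInv O F P N (i + 1) C' ∧
      OracleTM.DetReach (facetMachine p o) O (17 * roundCost n (matrixWord F))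
        (progCfg facetCode 0 litReg p o 1 (vecState C (matrixWord F) []))
        (progCfg facetCode 0 litReg p o (if i + 1 = n then 18 else 1)
          (vecState C' (matrixWord F) [])) := by
  have h1 := ask_record_detReach (p := p) (o := o) (C := C) (F := F) (O := O) (P := P) (N := N)
    (l₁ := 1) (r := .under) (f := fun v => v .pos) (g := fun v => v .neg)
    rfl rfl rfl rfl rfl rfl rfl rfl hi (fun j => by rw [← hC.pos, mem_regSet])
    (fun j => by rw [← hC.neg, mem_regSet]) hC.arg hC.under
  have h2 := ask_record_detReach (p := p) (o := o) (F := F) (O := O) (P := ∅) (N := ∅)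
    (C := putReg C .under (answers O F P N (i + 1)))
    (l₁ := 9) (r := .plain) (f := fun v => false) (g := fun v => false)
    rfl rfl rfl rfl rfl rfl rfl rfl hi (by simp) (by simp)
    (by rw [regSet_putReg_of_ne (by decide), hC.arg])
    (by rw [regSet_putReg_of_ne (by decide), hC.plain])
  have h3 := shift_detReach (p := p) (o := o) (O := O) (m := matrixWord F) hi
    (C := putReg (putReg C .under (answers O F P N (i + 1))) .plain (answers O F ∅ ∅ (i + 1)))
    (by rw [regSet_putReg_of_ne (by decide), regSet_putReg_of_ne (by decide), hC.arg])
  refine ⟨_, ⟨?_, ?_, ?_, ?_, ?_⟩, (h1.trans (h2.trans h3)).mono (by omega)⟩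
  · rw [regSet_putReg]
  · rw [regSet_putReg_of_ne (by decide), regSet_putReg_of_ne (by decide),
      regSet_putReg_of_ne (by decide), hC.pos]
  · rw [regSet_putReg_of_ne (by decide), regSet_putReg_of_ne (by decide),
      regSet_putReg_of_ne (by decide), hC.neg]
  · rw [regSet_putReg_of_ne (by decide), regSet_putReg_of_ne (by decide), regSet_putReg]
  · rw [regSet_putReg_of_ne (by decide), regSet_putReg]

/-- Here `k` counts the rounds after the current one. The machine tests for the end only after a
round, so at least one argument is needed. -/
theorem rounds_detReach {P N : Set (Fin n)} (k i : ℕ) (hi : i + k + 1 = n)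
    (hC : RoundInv O F P N i C) :
    ∃ C' : Fin n → Reg → Bool, RoundInv O F P N n C' ∧
      OracleTM.DetReach (facetMachine p o) O ((k + 1) * (17 * roundCost n (matrixWord F)))
        (progCfg facetCode 0 litReg p o 1 (vecState C (matrixWord F) []))
        (progCfg facetCode 0 litReg p o 18 (vecState C' (matrixWord F) [])) := by
  induction k generalizing i C with
  | zero =>
    obtain ⟨C', hC', hr⟩ := round_detReach (p := p) (o := o) (by omega) hC
    rw [if_pos (by omega)] at hr
    exact ⟨C', by rwa [show i + 1 = n by omega] at hC', by simpa using hr⟩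
  | succ k ih =>
    obtain ⟨C', hC', hr⟩ := round_detReach (p := p) (o := o) (by omega) hC
    rw [if_neg (by omega)] at hr
    obtain ⟨C'', hC'', hr'⟩ := ih (i + 1) (by omega) hC'
    exact ⟨C'', hC'', (hr.trans hr').mono (le_of_eq (by ring))⟩

end Argumentation

namespace Argumentation

open OracleComplexity Polynomial

variable {n : ℕ} {F : AF (Fin n)} {O : Set (List Bool)} {C : Fin n → Reg → Bool}
  {p : Prelude} {o : RegTape Reg}

/-- Columns outside `S` contribute no bit, so cardinalities come out in unary without any
arithmetic. -/
theorem filterMap_ofFn_eq_replicate {f : (Reg → Bool) → Bool} {S : Set (Fin n)}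
    (hS : ∀ j, f (C j) = true ↔ j ∈ S) :
    (List.ofFn C).filterMap (fun v => if f v then some true else none) =
      List.replicate S.ncard true := by
  obtain rfl : S = {j | f (C j) = true} := Set.ext fun j => (hS j).symm
  rw [Set.ncard_eq_toFinset_card']
  clear hS
  induction n with
  | zero => simp
  | succ n ih =>
    have := ih (C := fun j => C j.succ)
    simp only [Set.toFinset_ofPred] at this ⊢
    rw [List.ofFn_succ, Fin.card_filter_univ_succ, List.filterMap_cons, this]
    by_cases h : f (C 0) = true <;> simp [h, List.replicate_succ]

/-- The state with columns `C`, matrix `m` and output `w`. -/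
def outState (C : Fin n → Reg → Bool) (m w : List Bool) : RegState Reg where
  cols := List.ofFn C
  inp := m
  qry := []
  out := w

/-- The significance is put out. -/
theorem output_detReach {m : List Bool} {U Pl : Set (Fin n)} (hU : regSet C .under = U)
    (hPl : regSet C .plain = Pl) :
    OracleTM.DetReach (facetMachine p o) O (3 * roundCost n m)
      (progCfg facetCode 0 litReg p o 18 (vecState C m []))
      (progCfg facetCode 0 litReg p o 21 (outState C m
        (List.replicate (Pl \ U).ncard true ++ false :: List.replicate Pl.ncard true))) := by
  have hPl' : ∀ j, C j .plain = true ↔ j ∈ Pl := fun j => by rw [← hPl, mem_regSet]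
  have hU' : ∀ j, C j .under = true ↔ j ∈ U := fun j => by rw [← hU, mem_regSet]
  have hc : ∀ w, (outState C m w).cost ≤ roundCost n m :=
    fun w => vecState_cost_le (C := C) (m := m) (q := []) (by simp)
  have h1 : (facetCode 18).exec O (vecState C m []) =
      some (19, outState C m (List.replicate Pl.ncard true)) := by
    have h := filterMap_ofFn_eq_replicate (f := fun v => v .plain) hPl'
    change some ((19 : Fin 22), RegState.pushOn _ _ _) = _
    simpa [RegState.pushOn, vecState, outState] using h
  have h2 : (facetCode 19).exec O
      (outState C m (List.replicate Pl.ncard true)) =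
      some (20, outState C m (false :: List.replicate Pl.ncard true)) := by
    change some ((20 : Fin 22), RegState.pushOn _ _ _) = _
    simp [RegState.pushOn, outState]
  have h3 : (facetCode 20).exec O
      (outState C m (false :: List.replicate Pl.ncard true)) =
      some (21, outState C m
        (List.replicate (Pl \ U).ncard true ++ false :: List.replicate Pl.ncard true)) := by
    have h := filterMap_ofFn_eq_replicate (C := C) (f := fun v => v .plain && !v .under)
      (S := Pl \ U) (fun j => by rw [Set.mem_sdiff, ← hPl', ← hU']; simp)
    change some ((21 : Fin 22), RegState.pushOn _ _ _) = _
    simpa [RegState.pushOn, vecState, outState] using h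
  exact (((progMachine_exec h1).mono (hc _)).trans (((progMachine_exec h2).mono (hc _)).trans
    ((progMachine_exec h3).mono (hc _)))).mono (by omega)

/-- From the state after reading the input, the machine reaches its final state. -/
theorem facetMachine_detReach (hn : 0 < n) {P N : Set (Fin n)} (hP : regSet C .pos = P)
    (hN : regSet C .neg = N) (hu : regSet C .under = ∅) (hp : regSet C .plain = ∅) :
    ∃ C' : Fin n → Reg → Bool, regSet C' .under = answers O F P N n ∧
      regSet C' .plain = answers O F ∅ ∅ n ∧
      OracleTM.DetReach (facetMachine p o) O ((17 * n + 4) * roundCost n (matrixWord F))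
        (progCfg facetCode 0 litReg p o 0 (vecState C (matrixWord F) []))
        (progCfg facetCode 0 litReg p o 21 (outState C' (matrixWord F)
          (List.replicate (answers O F ∅ ∅ n \ answers O F P N n).ncard true ++
            false :: List.replicate (answers O F ∅ ∅ n).ncard true))) := by
  have h0 : ∀ P N : Set (Fin n), answers O F P N 0 = ∅ := fun P N => by simp [answers]
  have hC : RoundInv O F P N 0 (putReg C .arg {j | j.val = 0}) := by
    constructor
    · rw [regSet_putReg]
    · rw [regSet_putReg_of_ne (by decide), hP]
    · rw [regSet_putReg_of_ne (by decide), hN]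
    · rw [regSet_putReg_of_ne (by decide), hu, h0]
    · rw [regSet_putReg_of_ne (by decide), hp, h0]
  obtain ⟨C', hC', hr⟩ := rounds_detReach (p := p) (o := o) (n - 1) 0 (by omega) hC
  -- In units of `roundCost`: one to start, `17 * n` for the loop and three for the output.
  refine ⟨C', hC'.under, hC'.plain, ((start_detReach C).trans (hr.trans
    (output_detReach hC'.under hC'.plain))).mono (le_of_eq ?_)⟩
  rw [show n - 1 + 1 = n by omega]
  ring

/-- A time bound for the deterministic machine. -/
noncomputable def facetBound : ℕ[X] := 4 * X + 5 + (17 * X + 4) * (10 * (5 * X + 2) ^ 2)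

theorem time_le_facetBound {N : ℕ} {m : List Bool} (h : n + m.length ≤ N) :
    4 * N + 5 + (17 * n + 4) * roundCost n m ≤ facetBound.eval N := by
  have h1 : 5 * n + 2 * m.length + 2 ≤ 5 * N + 2 := by omega
  have h2 : n ≤ N := by omega
  simp only [facetBound, roundCost, eval_add, eval_mul, eval_ofNat, eval_X, eval_pow]
  gcongr

/-- The sets of positive and negative literals. -/
def litSets : Bool → Fin n → Set (Fin n) × Set (Fin n)
  | true, a => ({a}, ∅)
  | false, a => (∅, {a})

theorem facetMachine_columns (hn : 0 < n) :
    ∃ t ≤ facetBound.eval (List.replicate n true ++ false :: matrixWord F).length,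
      ∃ C' : Fin n → Reg → Bool, regSet C' .plain = answers O F ∅ ∅ n ∧ ∃ w,
      (facetMachine .columns o).ReachesIn O t
        ((facetMachine .columns o).init (List.replicate n true ++ false :: matrixWord F))
        (progCfg facetCode 0 litReg .columns o 21 (outState C' (matrixWord F) w)) := by
  have h1 := progMachine_columns (code := facetCode) (l₀ := 0) (lit := litReg) (o := o) (O := O)
    (List.replicate n true ++ false :: matrixWord F)
  rw [inputState_unary] at h1
  obtain ⟨C', -, hpl, h2⟩ := facetMachine_detReach (p := .columns) (o := o) (O := O) (F := F)
    (C := fun (j : Fin n) (r : Reg) => ([] : List Bool).getD j false) hn rfl rfl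
    (by simp [regSet]) (by simp [regSet])
  obtain ⟨t, ht, hr⟩ := (h1.trans h2).exists_reachesIn
  refine ⟨t, ht.trans (le_trans ?_ (time_le_facetBound (n := n) (m := matrixWord F) ?_)), C', hpl, _, hr⟩
  · have := unary_add_rest_le (List.replicate n true ++ false :: matrixWord F)
    omega
  · simp

theorem facetMachine_sign (s : Bool) (a : Fin n) :
    ∃ t ≤ facetBound.eval ((s :: (List.replicate a true ++ [false])) ++
        (List.replicate n true ++ false :: matrixWord F)).length,
      ∃ C' : Fin n → Reg → Bool,
      regSet C' .under = answers O F (litSets s a).1 (litSets s a).2 n ∧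
      (facetMachine .sign o).ReachesIn O t
        ((facetMachine .sign o).init ((s :: (List.replicate a true ++ [false])) ++
          (List.replicate n true ++ false :: matrixWord F)))
        (progCfg facetCode 0 litReg .sign o 21 (outState C' (matrixWord F)
          (List.replicate (answers O F ∅ ∅ n \
            answers O F (litSets s a).1 (litSets s a).2 n).ncard true ++
            false :: List.replicate (answers O F ∅ ∅ n).ncard true))) := by
  have hu : unaryLength (List.replicate n true ++ false :: matrixWord F) = n := by
    simp [unaryLength]
  have h1 := progMachine_sign (code := facetCode) (l₀ := 0) (lit := litReg) (o := o) (O := O) s a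
    (List.replicate n true ++ false :: matrixWord F) (by rw [hu]; exact a.2)
  rw [inputState_unary, hu] at h1
  -- The word `0ᵃ1`, padded by `false`, is the characteristic word of `{a}`.
  have hget : ∀ j : Fin n, (List.replicate a false ++ [true]).getD j false = true ↔ j = a := by
    intro j
    rw [List.getD_eq_getElem?_getD, List.getElem?_append]
    rcases lt_trichotomy j.val a.val with h | h | h
    · simp [h, Fin.ext_iff]
      omega
    · simp [h, Fin.ext_iff]
    · rw [if_neg (by simp; omega), List.getElem?_eq_none (by simp; omega)]
      simp [Fin.ext_iff]
      omega
  have hreg : ∀ r, regSet (fun (j : Fin n) (r : Reg) =>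
      (if r = litReg s then List.replicate a false ++ [true] else []).getD j false) r =
      if r = litReg s then {a} else ∅ := by
    intro r
    ext j
    rw [mem_regSet]
    by_cases h : r = litReg s
    · simp only [h, if_true, hget, Set.mem_singleton_iff]
    · simp [h]
  obtain ⟨C', hun, hpl, h2⟩ := facetMachine_detReach (p := .sign) (o := o) (O := O) (F := F)
    (P := (litSets s a).1) (N := (litSets s a).2)
    (Nat.lt_of_le_of_lt (Nat.zero_le _) a.2)
    (by rw [hreg]; cases s <;> simp [litReg, litSets])
    (by rw [hreg]; cases s <;> simp [litReg, litSets])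
    (by rw [hreg]; cases s <;> simp [litReg])
    (by rw [hreg]; cases s <;> simp [litReg])
  obtain ⟨t, ht, hr⟩ := (h1.trans h2).exists_reachesIn
  refine ⟨t, ht.trans (le_trans ?_ (time_le_facetBound (n := n) (m := matrixWord F) ?_)), C', hun, ?_⟩
  · simp
    omega
  · simp
    omega
  · convert hr using 2
    simp

/-! ### From oracle answers to facets and significance -/

theorem answers_lit {σ : Semantics} (hO : FacetOracle σ O) (s : Bool) (a : Fin n) :
    answers O F (litSets s a).1 (litSets s a).2 n = facetsUnder σ F (if s then .pos a else .neg a) := by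
  ext i
  have := hO n F (litSets s a).1 (litSets s a).2 i
  simp only [answers, Set.mem_ofPred_eq, i.2, true_and, this]
  cases s <;> simp [facetsUnder, cred, skep, approving, litSets, and_assoc]

theorem answers_empty {σ : Semantics} (hO : FacetOracle σ O) :
    answers O F ∅ ∅ n = facets σ F := by
  ext i
  have := hO n F ∅ ∅ i
  simp only [answers, Set.mem_ofPred_eq, i.2, true_and, this]
  simp [facets, cred, skep]

theorem halted_final (s : RegState Reg) :
    (facetMachine p o).Halted (progCfg facetCode 0 litReg p o 21 s) :=
  ⟨true, rfl⟩

/-- Between instructions all heads are at the left ends, so a register itself can serve as output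
tape. -/
theorem readWord_reg (l : Fin 22) (m w : List Bool) (r : Reg) :
    readWord ((progCfg facetCode 0 litReg p (.reg r) l
      (outState C m w)).tape (.reg r)) = setWord (regSet C r) := by
  have h : (progCfg facetCode 0 litReg p (.reg r) l (outState C m w)).tape (.reg r)
      = wordTape ((List.ofFn C).map (· r)) := rfl
  rw [h, readWord_wordTape, List.map_ofFn]
  exact setWord_eq_ofFn fun _ => Iff.rfl

theorem facetsComputable {𝒞 : Set (Set (List Bool))} {σ : Semantics} (hO : FacetOracle σ O)
    (h𝒞 : O ∈ 𝒞) : FacetsComputable 𝒞 σ := by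
  refine ⟨O, h𝒞, facetMachine .columns (.reg .plain), facetBound, facetMachine_deterministic _ _,
    fun I => ?_⟩
  obtain ⟨t, ht, C', hC', w, hr⟩ := facetMachine_columns (o := .reg .plain) (O := O) (F := I.F) I.n_pos
  refine ⟨t, ht, _, hr, halted_final _, ?_⟩
  change _ = setWord (facets σ I.F)
  rw [← answers_empty hO, ← hC']
  exact readWord_reg 21 _ _ _

theorem facetsUnderComputable {𝒞 : Set (Set (List Bool))} {σ : Semantics} (hO : FacetOracle σ O)
    (h𝒞 : O ∈ 𝒞) : FacetsUnderComputable 𝒞 σ := by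
  refine ⟨O, h𝒞, facetMachine .sign (.reg .under), facetBound, facetMachine_deterministic _ _,
    fun I => ?_⟩
  obtain ⟨J, ℓ⟩ := I
  obtain ⟨s, a, hs⟩ : ∃ (s : Bool) (a : Fin J.n), ℓ = if s then .pos a else .neg a := by
    cases ℓ with
    | pos a => exact ⟨true, a, rfl⟩
    | neg a => exact ⟨false, a, rfl⟩
  obtain ⟨t, ht, C', hC', hr⟩ := facetMachine_sign (o := .reg .under) (O := O) (F := J.F) s a
  have hw : FinAFLit.word ⟨J, ℓ⟩ = (s :: (List.replicate a true ++ [false])) ++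
      (List.replicate J.n true ++ false :: matrixWord J.F) := by
    subst hs
    cases s <;> rfl
  rw [hw]
  refine ⟨t, ht, _, hr, halted_final _, ?_⟩
  change _ = setWord (facetsUnder σ J.F ℓ)
  rw [hs, ← answers_lit hO, ← hC']
  exact readWord_reg 21 _ _ _

/-- The two extensions that witness a facet under a literal witness a facet. This turns the
numerator of the significance into the cardinality of a set difference. -/
theorem facetsUnder_subset {A : Type*} (σ : Semantics) (F : AF A) (ℓ : Literal A) :
    facetsUnder σ F ℓ ⊆ facets σ F := by
  have h : approving (σ.extensions F) ℓ ⊆ σ.extensions F := by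
    cases ℓ <;> exact Set.sep_subset _ _
  rintro b ⟨⟨E, hE, hb⟩, hs⟩
  exact ⟨⟨E, h hE, hb⟩, fun hs' => hs fun E hE => hs' E (h hE)⟩

theorem significanceComputable {𝒞 : Set (Set (List Bool))} {σ : Semantics} (hO : FacetOracle σ O)
    (h𝒞 : O ∈ 𝒞) : SignificanceComputable 𝒞 σ := by
  refine ⟨O, h𝒞, facetMachine .sign .out, facetBound, facetMachine_deterministic _ _,
    fun I => ?_⟩
  obtain ⟨⟨J, ℓ⟩, hI⟩ := I
  obtain ⟨s, a, hs⟩ : ∃ (s : Bool) (a : Fin J.n), ℓ = if s then .pos a else .neg a := by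
    cases ℓ with
    | pos a => exact ⟨true, a, rfl⟩
    | neg a => exact ⟨false, a, rfl⟩
  obtain ⟨t, ht, C', hC', hr⟩ := facetMachine_sign (o := .out) (O := O) (F := J.F) s a
  have hw : FinAFLit.word ⟨J, ℓ⟩ = (s :: (List.replicate a true ++ [false])) ++
      (List.replicate J.n true ++ false :: matrixWord J.F) := by
    subst hs
    cases s <;> rfl
  change ∃ t ≤ facetBound.eval (FinAFLit.word ⟨J, ℓ⟩).length, ∃ c,
    (facetMachine .sign .out).ReachesIn O t ((facetMachine .sign .out).init (FinAFLit.word ⟨J, ℓ⟩)) c ∧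
    (facetMachine .sign .out).Halted c ∧
    RepresentsRat (significance σ J.F ℓ) (readWord (c.tape .out))
  rw [hw]
  refine ⟨t, ht, _, hr, halted_final _, ?_⟩
  rw [answers_lit hO, answers_empty hO, ← hs]
  -- The argument of the literal is itself a facet, so the denominator is positive.
  have hpos : 0 < (facets σ J.F).ncard := (Set.ncard_pos (Set.toFinite _)).2 ⟨_, hI⟩
  refine ⟨_, _, hpos, ?_, readWord_wordTape _⟩
  rw [significance, Set.ncard_sdiff (facetsUnder_subset σ J.F ℓ) (Set.toFinite _), Nat.cast_sub
    (Set.ncard_le_ncard (facetsUnder_subset σ J.F ℓ) (Set.toFinite _))]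

end Argumentation

open Argumentation OracleComplexity in
theorem mainTheorem8 (σ : Argumentation.Semantics) :
    (σ ∈ ({.adm, .comp, .stab} : Set Argumentation.Semantics) →
      Argumentation.FacetsComputable OracleComplexity.NP σ ∧
      Argumentation.FacetsUnderComputable OracleComplexity.NP σ ∧
      Argumentation.SignificanceComputable OracleComplexity.NP σ) ∧
    (σ ∈ ({.pref, .semi, .stag} : Set Argumentation.Semantics) →
      Argumentation.FacetsComputable OracleComplexity.Sigma2P σ ∧
      Argumentation.FacetsUnderComputable OracleComplexity.Sigma2P σ ∧
      Argumentation.SignificanceComputable OracleComplexity.Sigma2P σ) := by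
  constructor
  · intro hσ
    -- These semantics need no maximality query, so the empty oracle suffices and the facet language
    -- lies in `NPRel ∅ = NP`.
    have hI : ImproveOracle σ ∅ := by rcases hσ with rfl | rfl | rfl <;> trivial
    have hO := facetOracle_facetLanguage σ hI
    have hM : facetLanguage σ ∅ ∈ NP := facetLanguage_mem_NPRel σ ∅
    exact ⟨facetsComputable hO hM, facetsUnderComputable hO hM, significanceComputable hO hM⟩
  · intro _
    -- The improvement language is the inner `NP` oracle that places the facet language in
    -- `Sigma2P`.
    have hO := facetOracle_facetLanguage σ (improveOracle_improveLanguage σ)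
    have hM : facetLanguage σ (improveLanguage σ) ∈ Sigma2P :=
      ⟨_, improveLanguage_mem_NP σ, facetLanguage_mem_NPRel σ _⟩
    exact ⟨facetsComputable hO hM, facetsUnderComputable hO hM, significanceComputable hO hM⟩
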